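/- A group is called virtually abelian if it contains an abelian subgroup of finite index, and $K$-virtually abelian if it contains an abelian subgroup of index at most $K$. For an integer $K>0$, a group $G$ is called $K$-CSA if (1) every finite subgroup of $G$ has cardinality at most $K$; (2) every element $g\in G$ of infinite order is contained in a unique maximal virtually abelian subgroup $M(g)$ of $G$, and $M(g)$ is $K$-virtually abelian; (3) each such $M(g)$ is equal to its own normalizer in $G$. The space of groups marked by $n$ generators is the set of normal subgroups $N$ of the free group $F_n$ (standing for the group $F_n/N$ with the images of the free generators), with the topology induced by the product topology on $\{0,1\}^{F_n}$. Given a group $\Gamma$, a $\Gamma$-limit group is a finitely generated group $G$ such that, for some $n$ and some epimorphism $f:F_n\to G$, the kernel of $f$ lies in the closure of $\{\ker\varphi : \varphi\in\mathrm{Hom}(F_n,\Gamma)\}$ in this space. A group is hyperbolic if it has a finite generating set whose word metric is Gromov hyperbolic. (a) For every fixed $K>0$, there is a set of universal first-order sentences in the language of groups such that a group is $K$-CSA if and only if it satisfies all of them. Every subgroup of a $K$-CSA group is $K$-CSA, and for every $n$ the set of $K$-CSA groups is closed in the space of groups marked by $n$ generators. (b) For every hyperbolic group $\Gamma$ there exists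 $K>0$ such that every $\Gamma$-limit group $G$ is $K$-CSA and, moreover, every subgroup of $G$ contains a non-abelian free group $F_2$ of rank two or is $K$-virtually abelian. -/

import Mathlib

universe u v w

namespace KCSA

/-! ### Virtually abelian groups and `K`-CSA groups -/

/-- `G` is virtually abelian: it contains an abelian subgroup of finite index. -/
def IsVirtuallyAbelian (G : Type u) [Group G] : Prop :=
  ∃ A : Subgroup G, (∀ a ∈ A, ∀ b ∈ A, a * b = b * a) ∧ A.FiniteIndex

/-- `G` is `K`-virtually abelian: it contains an abelian subgroup of (finite) index at most `K`.
(`Subgroup.index` is `0` for a subgroup of infinite index, hence the condition `A.FiniteIndex`.) -/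
def IsKVirtuallyAbelian (K : ℕ) (G : Type u) [Group G] : Prop :=
  ∃ A : Subgroup G, (∀ a ∈ A, ∀ b ∈ A, a * b = b * a) ∧ A.FiniteIndex ∧ A.index ≤ K

/-- `M` is a maximal virtually abelian subgroup of `G`. -/
def IsMaximalVirtuallyAbelian {G : Type u} [Group G] (M : Subgroup G) : Prop :=
  Maximal (fun H : Subgroup G => IsVirtuallyAbelian H) M

/-- `G` is `K`-CSA: finite subgroups have cardinality at most `K`; every element `g` of infinite
order lies in a unique maximal virtually abelian subgroup `M(g)`; the group `M(g)` is `K`-virtually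
abelian and equal to its own normalizer. -/
structure IsKCSA (K : ℕ) (G : Type u) [Group G] : Prop where
  card_le : ∀ F : Subgroup G, Finite F → Nat.card F ≤ K
  existsUnique_maximal : ∀ g : G, ¬ IsOfFinOrder g →
    ∃! M : Subgroup G, IsMaximalVirtuallyAbelian M ∧ g ∈ M
  isKVirtuallyAbelian : ∀ g : G, ¬ IsOfFinOrder g →
    ∀ M : Subgroup G, IsMaximalVirtuallyAbelian M → g ∈ M → IsKVirtuallyAbelian K M
  normalizer_eq : ∀ g : G, ¬ IsOfFinOrder g →
    ∀ M : Subgroup G, IsMaximalVirtuallyAbelian M → g ∈ M →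
      Subgroup.normalizer (M : Set G) = M

/-! ### The first-order language of groups -/

/-- Function symbols of the language of groups: multiplication, inverse, identity. -/
inductive GroupFunc : ℕ → Type
  | mul : GroupFunc 2
  | inv : GroupFunc 1
  | one : GroupFunc 0

/-- The first-order language of groups. -/
def groupLanguage : FirstOrder.Language.{0, 0} where
  Functions := GroupFunc
  Relations := fun _ => Empty

/-- Every group is a structure for the language of groups, in the usual way. -/
instance groupStructure (G : Type u) [Group G] : groupLanguage.Structure G where
  funMap := fun f x =>
    match f, x with
    | GroupFunc.mul, x => x 0 * x 1
    | GroupFunc.inv, x => (x 0)⁻¹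
    | GroupFunc.one, _ => 1
  RelMap := fun r _ => r.elim

/-! ### The space of marked groups -/

/-- A marked group on `n` generators: a group with an `n`-tuple of generators, that is an
epimorphism from the free group on `n` generators, up to isomorphism of marked groups. Such a class
is determined by the kernel of the epimorphism, an arbitrary normal subgroup of the free group. -/
structure MarkedGroup (n : ℕ) where
  ker : Subgroup (FreeGroup (Fin n))
  normal : ker.Normal

attribute [instance] MarkedGroup.normal

/-- The underlying group of a marked group. -/
abbrev MarkedGroup.group {n : ℕ} (N : MarkedGroup n) : Type := FreeGroup (Fin n) ⧸ N.ker

/-- The topology of the space of marked groups, induced by the product topology on the power set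
`{0, 1} ^ F_n` of the free group: two marked groups are close when their kernels agree on a large
finite set of words. -/
noncomputable instance (n : ℕ) : TopologicalSpace (MarkedGroup n) :=
  open scoped Classical in
  TopologicalSpace.induced
    (fun (N : MarkedGroup n) (w : FreeGroup (Fin n)) => decide (w ∈ N.ker)) Pi.topologicalSpace

/-- The marked group given by the image of a homomorphism from a free group,
marked by the images of the free generators. -/
def MarkedGroup.ofHom {n : ℕ} {G : Type u} [Group G] (f : FreeGroup (Fin n) →* G) :
    MarkedGroup n where
  ker := f.ker
  normal := inferInstance

/-- `G` is a `Γ`-limit group: it is finitely generated and, for some finite marking, it is a limit,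
in the space of marked groups, of marked subgroups of `Γ`. -/
def IsLimitGroup (Γ : Type u) [Group Γ] (G : Type v) [Group G] : Prop :=
  ∃ (n : ℕ) (f : FreeGroup (Fin n) →* G), Function.Surjective f ∧
    MarkedGroup.ofHom f ∈
      closure (Set.range fun φ : FreeGroup (Fin n) →* Γ => MarkedGroup.ofHom φ)

/-! ### Hyperbolic groups -/

/-- The length of `g` with respect to `S`: the least length of a word in `S ∪ S⁻¹` representing `g`.
(It is used only when `S` generates the group.) -/
noncomputable def wordLength {G : Type u} [Group G] (S : Set G) (g : G) : ℕ :=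
  sInf {n : ℕ | ∃ l : List G, (∀ x ∈ l, x ∈ S ∨ x⁻¹ ∈ S) ∧ l.prod = g ∧ l.length = n}

/-- The (left-invariant) word metric with respect to `S`. -/
noncomputable def wordDist {G : Type u} [Group G] (S : Set G) (x y : G) : ℕ :=
  wordLength S (x⁻¹ * y)

/-- `G` is a hyperbolic group: it has a finite generating set whose word metric satisfies Gromov's
four-point condition. -/
def IsHyperbolicGroup (G : Type u) [Group G] : Prop :=
  ∃ S : Set G, S.Finite ∧ Subgroup.closure S = ⊤ ∧ ∃ δ : ℕ, ∀ x y z w : G,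
    wordDist S x y + wordDist S z w ≤
      max (wordDist S x z + wordDist S y w) (wordDist S x w + wordDist S y z) + 2 * δ

/-! ### Non-abelian free subgroups -/

/-- `G` contains a free group of rank two. -/
def ContainsFreeGroupTwo (G : Type u) [Group G] : Prop :=
  ∃ f : FreeGroup (Fin 2) →* G, Function.Injective f

end KCSA

/-! Part (a). In a `K`-CSA group an element `g` has infinite order iff `g ^ K!` is nontrivial, and
then `M(g)` is the quantifier-free definable set of those `x` for which `x * g ^ K! * x⁻¹` and `g ^
K!` commute (`IsKCSA.mem_iff`). Being `K`-virtually abelian is equivalent to having a colouring with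
`K` colours in which quotients of elements of equal colour commute
(`isKVirtuallyAbelian_iff_colouring`); by compactness it is enough to colour finite subsets. So
`K`-CSA is equivalent to a family of statements "every `m`-tuple satisfies a given Boolean
combination of word equations" (`KCSAAxiom`, `isKCSA_iff_satisfies`). Such statements are universal
sentences, pass to subgroups, and define closed sets of marked groups. In particular they pass from
`Γ` to `Γ`-limit groups (`IsLocal.satisfies_of_isLimitGroup`).

Part (b) therefore reduces to uniform statements about the hyperbolic group `Γ` itself. An analogue
of Serre's lemma (`exists_growth`) bounds finite subgroups and shows that a power of bounded
exponent of any element of infinite order has, up to conjugation, a long quasi-axis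
(`exists_isAxial`). The elements `x` for which some power of `g` commutes with its conjugate by `x`
lie in a subgroup with at most two cosets of the centralizer of some power of `g`. That centralizer
is virtually infinite cyclic, and the transfer bounds the index of an abelian subgroup in terms of
the order of its finite subgroups alone. This gives `K`-CSA for `Γ`. If no power of `g` commutes
with its conjugate by `x`, the quasi-axes of `g` and `x * g * x⁻¹` overlap boundedly, and for one
exponent `N`, independent of `g` and `x`, the elements `g ^ N` and `x * g ^ N * x⁻¹` generate a free
group (`exists_injective_lift`). Uniformity of `N` makes freeness a list of universal conditions,
one for each nontrivial word, so the Tits alternative also passes to limit groups. -/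

namespace KCSA

open scoped commutatorElement

/-! ### Virtually abelian groups as groups with a colouring -/

section VirtuallyAbelian

variable {G : Type*} [Group G]

/-- A colouring whose monochromatic differences commute. -/
def IsAbelianColouring {α : Type*} (K : ℕ) (x : α → G) (c : α → Fin K) : Prop :=
  ∀ i j k l, c i = c j → c k = c l → ⁅(x i)⁻¹ * x j, (x k)⁻¹ * x l⁆ = 1

/-- Colour elements by their cosets of an abelian subgroup. Conversely, the quotients of elements of
equal colour commute, so they generate an abelian subgroup, and distinct cosets of it carry distinct
colours. -/
theorem isKVirtuallyAbelian_iff_colouring {K : ℕ} :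
    IsKVirtuallyAbelian K G ↔ ∃ c : G → Fin K, IsAbelianColouring K id c := by
  constructor
  · rintro ⟨A, hA, hfin, hK⟩
    have : Finite (G ⧸ A) := A.finite_quotient_of_finiteIndex
    have hcard : Nat.card (G ⧸ A) ≤ K := hK
    obtain ⟨e⟩ : Nonempty ((G ⧸ A) ↪ Fin K) := by
      have := Fintype.ofFinite (G ⧸ A)
      rw [Nat.card_eq_fintype_card] at hcard
      exact Function.Embedding.nonempty_of_card_le (by simpa using hcard)
    refine ⟨fun x => e (x : G ⧸ A), fun i j k l hij hkl => ?_⟩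
    have h1 := QuotientGroup.eq.1 (e.injective hij)
    have h2 := QuotientGroup.eq.1 (e.injective hkl)
    exact commutatorElement_eq_one_iff_mul_comm.2 (hA _ h1 _ h2)
  · rintro ⟨c, hc⟩
    set s : Set G := {z | ∃ x y, c x = c y ∧ z = x⁻¹ * y} with hs
    have hcomm : ∀ x ∈ s, ∀ y ∈ s, x * y = y * x := by
      rintro _ ⟨x, y, h, rfl⟩ _ ⟨z, w, h', rfl⟩
      exact commutatorElement_eq_one_iff_mul_comm.1 (hc x y z w h h')
    have hinj : Function.Injective fun q : G ⧸ Subgroup.closure s => c q.out := by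
      intro q q' h
      have : (q.out : G ⧸ Subgroup.closure s) = q'.out :=
        QuotientGroup.eq.2 (Subgroup.subset_closure ⟨_, _, h, rfl⟩)
      simpa using this
    have hf : Finite (G ⧸ Subgroup.closure s) := Finite.of_injective _ hinj
    refine ⟨Subgroup.closure s, ?_, Subgroup.finiteIndex_of_finite_quotient, ?_⟩
    · have := Subgroup.isMulCommutative_closure hcomm
      intro a ha b hb
      exact congrArg Subtype.val (mul_comm' (⟨a, ha⟩ : Subgroup.closure s) ⟨b, hb⟩)
    · simpa [Subgroup.index] using Nat.card_le_card_of_injective _ hinj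

theorem isVirtuallyAbelian_iff : IsVirtuallyAbelian G ↔ ∃ K, IsKVirtuallyAbelian K G :=
  ⟨fun ⟨A, h, h'⟩ => ⟨A.index, A, h, h', le_rfl⟩, fun ⟨_, A, h, h', _⟩ => ⟨A, h, h'⟩⟩

theorem IsKVirtuallyAbelian.isVirtuallyAbelian {K : ℕ} (h : IsKVirtuallyAbelian K G) :
    IsVirtuallyAbelian G :=
  isVirtuallyAbelian_iff.2 ⟨K, h⟩

theorem IsKVirtuallyAbelian.mono {K L : ℕ} (h : IsKVirtuallyAbelian K G) (hKL : K ≤ L) :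
    IsKVirtuallyAbelian L G :=
  let ⟨A, h1, h2, h3⟩ := h
  ⟨A, h1, h2, h3.trans hKL⟩

theorem IsKVirtuallyAbelian.of_injective {H : Type*} [Group H] {K : ℕ}
    (h : IsKVirtuallyAbelian K G) (f : H →* G) (hf : Function.Injective f) :
    IsKVirtuallyAbelian K H := by
  obtain ⟨c, hc⟩ := isKVirtuallyAbelian_iff_colouring.1 h
  refine isKVirtuallyAbelian_iff_colouring.2 ⟨c ∘ f, fun i j k l hij hkl => hf ?_⟩
  simpa [map_commutatorElement] using hc _ _ _ _ hij hkl

theorem IsVirtuallyAbelian.of_injective {H : Type*} [Group H]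
    (h : IsVirtuallyAbelian G) (f : H →* G) (hf : Function.Injective f) :
    IsVirtuallyAbelian H := by
  obtain ⟨K, hK⟩ := isVirtuallyAbelian_iff.1 h
  exact (hK.of_injective f hf).isVirtuallyAbelian

theorem IsKVirtuallyAbelian.mono_subgroup {K : ℕ} {H H' : Subgroup G}
    (h : IsKVirtuallyAbelian K H') (hle : H ≤ H') : IsKVirtuallyAbelian K H :=
  h.of_injective (Subgroup.inclusion hle) (Subgroup.inclusion_injective hle)

theorem isVirtuallyAbelian_of_comm (h : ∀ a b : G, a * b = b * a) : IsVirtuallyAbelian G :=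
  ⟨⊤, fun a _ b _ => h a b, inferInstance⟩

theorem IsKVirtuallyAbelian.commute_pow_factorial {K : ℕ} (h : IsKVirtuallyAbelian K G) (x y : G) :
    Commute (x ^ K.factorial) (y ^ K.factorial) := by
  obtain ⟨A, hA, hfin, hK⟩ := h
  have key : ∀ z : G, z ^ K.factorial ∈ A := by
    intro z
    obtain ⟨n, hn, hnA, hz⟩ := Subgroup.exists_pow_mem_of_index_ne_zero hfin.index_ne_zero z
    obtain ⟨m, hm⟩ := Nat.dvd_factorial hn (hnA.trans hK)
    rw [hm, pow_mul]
    exact A.pow_mem hz m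
  exact hA _ (key x) _ (key y)

/-- The commutator of `x * g ^ k * x⁻¹` and `g ^ k`. -/
def conjComm (g x : G) (k : ℕ) : G := ⁅x * g ^ k * x⁻¹, g ^ k⁆

theorem map_conjComm {H F : Type*} [Group H] [FunLike F G H] [MonoidHomClass F G H] (f : F)
    (g x : G) (k : ℕ) : f (conjComm g x k) = conjComm (f g) (f x) k := by
  simp [conjComm, map_commutatorElement]

theorem conjComm_eq_one_iff {g x : G} {k : ℕ} :
    conjComm g x k = 1 ↔ Commute (x * g ^ k * x⁻¹) (g ^ k) :=
  commutatorElement_eq_one_iff_mul_comm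

theorem IsKVirtuallyAbelian.conjComm_eq_one {K : ℕ} {H : Subgroup G}
    (h : IsKVirtuallyAbelian K H) {g x : G} (hg : g ∈ H) (hx : x * g * x⁻¹ ∈ H) :
    conjComm g x K.factorial = 1 := by
  have := h.commute_pow_factorial ⟨_, hx⟩ ⟨_, hg⟩
  have := congrArg Subtype.val this.eq
  rw [conjComm_eq_one_iff]
  simpa [conj_pow, Commute, SemiconjBy] using this

theorem IsVirtuallyAbelian.exists_conjComm_eq_one {H : Subgroup G}
    (h : IsVirtuallyAbelian H) {g x : G} (hg : g ∈ H) (hx : x * g * x⁻¹ ∈ H) :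
    ∃ k, 0 < k ∧ conjComm g x k = 1 := by
  obtain ⟨K, hK⟩ := isVirtuallyAbelian_iff.1 h
  exact ⟨K.factorial, K.factorial_pos, hK.conjComm_eq_one hg hx⟩

theorem IsMaximalVirtuallyAbelian.map_conj {M : Subgroup G} (h : IsMaximalVirtuallyAbelian M)
    (x : G) : IsMaximalVirtuallyAbelian (M.map (MulAut.conj x).toMonoidHom) := by
  have key : ∀ (y : G) (H : Subgroup G), IsVirtuallyAbelian H →
      IsVirtuallyAbelian (H.map (MulAut.conj y).toMonoidHom) := by
    intro y H hH
    refine hH.of_injective (H.equivMapOfInjective _ (MulAut.conj y).injective).symm.toMonoidHom ?_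
    exact (H.equivMapOfInjective _ (MulAut.conj y).injective).symm.injective
  refine ⟨key x M h.1, fun H hH hle => ?_⟩
  have h1 := h.2 (key x⁻¹ H hH) (by
    intro m hm
    refine ⟨x * m * x⁻¹, hle ⟨m, hm, by simp⟩, by simp [mul_assoc]⟩)
  intro y hy
  refine ⟨x⁻¹ * y * x, h1 ⟨y, hy, by simp⟩, by simp [mul_assoc]⟩

end VirtuallyAbelian

/-! ### An elementary characterization of `K`-CSA groups -/

section KCSA

variable {G : Type*} [Group G] {K : ℕ}

theorem not_isOfFinOrder_pow {g : G} (hg : ¬ IsOfFinOrder g) {k : ℕ} (hk : 0 < k) :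
    ¬ IsOfFinOrder (g ^ k) := by
  rw [isOfFinOrder_pow]
  simp [hg, hk.ne']

theorem not_isOfFinOrder_conj {g : G} (hg : ¬ IsOfFinOrder g) (x : G) :
    ¬ IsOfFinOrder (x * g * x⁻¹) := by
  rw [isOfFinOrder_iff_pow_eq_one] at hg ⊢
  simpa [conj_pow] using hg

namespace IsKCSA

theorem isOfFinOrder_iff (h : IsKCSA K G) {g : G} :
    IsOfFinOrder g ↔ g ^ K.factorial = 1 := by
  constructor
  · intro hg
    have hfin : Finite (Subgroup.zpowers g) := by
      rw [← Nat.card_pos_iff.trans (and_iff_right ⟨1⟩)]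
      rw [Nat.card_zpowers]
      exact hg.orderOf_pos
    have := h.card_le _ hfin
    rw [Nat.card_zpowers] at this
    exact orderOf_dvd_iff_pow_eq_one.1 (Nat.dvd_factorial hg.orderOf_pos this)
  · intro hg
    exact isOfFinOrder_iff_pow_eq_one.2 ⟨_, K.factorial_pos, hg⟩

/-- Both `M` and its conjugate by `x` are maximal and contain `x * g * x⁻¹`. By uniqueness they
agree, so `x` normalizes `M`, which is its own normalizer. -/
theorem mem_of_conj_mem (h : IsKCSA K G) {M : Subgroup G} (hM : IsMaximalVirtuallyAbelian M)
    {g x : G} (hg : ¬ IsOfFinOrder g) (hgM : g ∈ M) (hx : x * g * x⁻¹ ∈ M) : x ∈ M := by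
  have h1 : M.map (MulAut.conj x).toMonoidHom = M :=
    (h.existsUnique_maximal _ (not_isOfFinOrder_conj hg x)).unique
      ⟨hM.map_conj x, ⟨g, hgM, by simp⟩⟩ ⟨hM, hx⟩
  rw [← h.normalizer_eq g hg M hM hgM, Subgroup.mem_normalizer_iff]
  intro y
  constructor
  · intro hy
    rw [← h1]
    exact ⟨y, hy, by simp⟩
  · intro hy
    rw [← h1] at hy
    obtain ⟨z, hz, hzy⟩ := hy
    have : z = y := by simpa using hzy
    exact this ▸ hz

/-- Uniqueness of `M` is not enough by itself, since `B` is not known to lie in a maximal virtually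
abelian subgroup. Instead, a power of `g` lies in the normal core of an abelian subgroup of `B`. The
core centralizes this power, hence lies in `M`; any `b` in `B` conjugates the power into the core,
hence into `M`. Both steps use `mem_of_conj_mem`. -/
theorem le_of_isVirtuallyAbelian (h : IsKCSA K G) {M : Subgroup G}
    (hM : IsMaximalVirtuallyAbelian M) {g : G} (hg : ¬ IsOfFinOrder g) (hgM : g ∈ M)
    {B : Subgroup G} (hB : IsVirtuallyAbelian B) (hgB : g ∈ B) : B ≤ M := by
  obtain ⟨A, hA, hfin⟩ := hB
  obtain ⟨k, hk, -, hkA⟩ := Subgroup.exists_pow_mem_of_index_ne_zero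
    (H := A.normalCore) (Subgroup.FiniteIndex.index_ne_zero) (⟨g, hgB⟩ : B)
  have hinf := not_isOfFinOrder_pow hg hk
  have hkM : g ^ k ∈ M := M.pow_mem hgM k
  have hcore : ∀ a : B, a ∈ A.normalCore → (a : G) ∈ M := by
    intro a ha
    refine h.mem_of_conj_mem hM hinf hkM ?_
    have := congrArg Subtype.val
      (hA a (A.normalCore_le ha) _ (A.normalCore_le hkA))
    simp only [Subgroup.coe_mul, Subgroup.coe_pow] at this
    rwa [this, mul_inv_cancel_right]
  intro b hb
  refine h.mem_of_conj_mem hM hinf hkM ?_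
  exact hcore _ (A.normalCore_normal.conj_mem _ hkA ⟨b, hb⟩)

/-- The commuting elements `g ^ k` and `x * g ^ k * x⁻¹` generate an abelian subgroup, which lies in
`M` because it contains `g ^ k`. -/
theorem mem_of_conjComm_eq_one (h : IsKCSA K G) {M : Subgroup G}
    (hM : IsMaximalVirtuallyAbelian M) {g : G} (hg : ¬ IsOfFinOrder g) (hgM : g ∈ M)
    {x : G} {k : ℕ} (hk : 0 < k) (hx : conjComm g x k = 1) : x ∈ M := by
  have hinf := not_isOfFinOrder_pow hg hk
  have hkM : g ^ k ∈ M := M.pow_mem hgM k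
  refine h.mem_of_conj_mem hM hinf hkM ?_
  rw [conjComm_eq_one_iff] at hx
  have hcomm : ∀ a ∈ ({x * g ^ k * x⁻¹, g ^ k} : Set G),
      ∀ b ∈ ({x * g ^ k * x⁻¹, g ^ k} : Set G), a * b = b * a := by
    rintro a (rfl | rfl) b (rfl | rfl)
    exacts [rfl, hx.eq, hx.eq.symm, rfl]
  have := Subgroup.isMulCommutative_closure hcomm
  exact h.le_of_isVirtuallyAbelian hM hinf hkM
    (B := Subgroup.closure {x * g ^ k * x⁻¹, g ^ k}) (isVirtuallyAbelian_of_comm fun a b => mul_comm' a b)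
    (Subgroup.subset_closure (by simp)) (Subgroup.subset_closure (by simp))

theorem mem_iff (h : IsKCSA K G) {M : Subgroup G}
    (hM : IsMaximalVirtuallyAbelian M) {g : G} (hg : ¬ IsOfFinOrder g) (hgM : g ∈ M) {x : G} :
    x ∈ M ↔ conjComm g x K.factorial = 1 :=
  ⟨fun hx => (h.isKVirtuallyAbelian g hg M hM hgM).conjComm_eq_one hgM
    (M.mul_mem (M.mul_mem hx hgM) (M.inv_mem hx)),
    fun hx => h.mem_of_conjComm_eq_one hM hg hgM K.factorial_pos hx⟩

/-- A criterion: it suffices to find, for each `g` of infinite order, a `K`-virtually abelian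
subgroup containing all `x` for which powers of `g` and `x * g * x⁻¹` commute. -/
theorem of_subgroups (h1 : ∀ F : Subgroup G, Finite F → Nat.card F ≤ K)
    (h2 : ∀ g : G, ¬ IsOfFinOrder g → ∃ E : Subgroup G, IsKVirtuallyAbelian K E ∧
      ∀ (x : G) (k : ℕ), 0 < k → conjComm g x k = 1 → x ∈ E) : IsKCSA K G := by
  have key : ∀ g : G, ¬ IsOfFinOrder g → ∃ E : Subgroup G, IsKVirtuallyAbelian K E ∧ g ∈ E ∧
      (∀ M, IsMaximalVirtuallyAbelian M → g ∈ M → M = E) ∧ IsMaximalVirtuallyAbelian E ∧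
      Subgroup.normalizer (E : Set G) = E := by
    intro g hg
    obtain ⟨E, hE, hmem⟩ := h2 g hg
    have hgE : g ∈ E := hmem g 1 one_pos (by simp [conjComm])
    have hle : ∀ B : Subgroup G, IsVirtuallyAbelian B → g ∈ B → B ≤ E := by
      intro B hB hgB b hb
      obtain ⟨k, hk, hk'⟩ := hB.exists_conjComm_eq_one hgB
        (B.mul_mem (B.mul_mem hb hgB) (B.inv_mem hb))
      exact hmem b k hk hk'
    refine ⟨E, hE, hgE, fun M hM hgM => ?_, ⟨hE.isVirtuallyAbelian, ?_⟩, ?_⟩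
    · exact le_antisymm (hle M hM.1 hgM) (hM.2 hE.isVirtuallyAbelian (hle M hM.1 hgM))
    · intro B hB hEB
      exact hle B hB (hEB hgE)
    · refine le_antisymm (fun x hx => ?_) Subgroup.le_normalizer
      rw [Subgroup.mem_normalizer_iff] at hx
      obtain ⟨k, hk, hk'⟩ := hE.isVirtuallyAbelian.exists_conjComm_eq_one hgE ((hx g).1 hgE)
      exact hmem x k hk hk'
  refine ⟨h1, fun g hg => ?_, fun g hg M hM hgM => ?_, fun g hg M hM hgM => ?_⟩
  · obtain ⟨E, -, hgE, hu, hE, -⟩ := key g hg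
    exact ⟨E, ⟨hE, hgE⟩, fun M hM => hu M hM.1 hM.2⟩
  · obtain ⟨E, hKE, hgE, hu, hE, -⟩ := key g hg
    rw [hu M hM hgM]
    exact hKE
  · obtain ⟨E, hKE, hgE, hu, hE, hn⟩ := key g hg
    rw [hu M hM hgM]
    exact hn

end IsKCSA

end KCSA

end KCSA

namespace KCSA

open FirstOrder FirstOrder.Language
open scoped commutatorElement

/-! ### Quantifier-free conditions on tuples of elements of a group -/

section Local

/-- Boolean combinations of conditions `w ∈ S`, for words `w`. -/
inductive IsLocal {α : Type} : (Set (FreeGroup α) → Prop) → Prop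
  | mem (w : FreeGroup α) : IsLocal fun S => w ∈ S
  | false : IsLocal fun _ => False
  | imp {P Q : Set (FreeGroup α) → Prop} (hP : IsLocal P) (hQ : IsLocal Q) :
      IsLocal fun S => P S → Q S

namespace IsLocal

variable {α : Type} {P Q : Set (FreeGroup α) → Prop}

theorem not (hP : IsLocal P) : IsLocal fun S => ¬ P S := hP.imp .false

theorem or (hP : IsLocal P) (hQ : IsLocal Q) : IsLocal fun S => P S ∨ Q S := by
  have := hP.not.imp hQ
  simpa only [← or_iff_not_imp_left] using this

theorem and (hP : IsLocal P) (hQ : IsLocal Q) : IsLocal fun S => P S ∧ Q S := by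
  have := (hP.imp hQ.not).not
  simpa only [Classical.not_imp, not_not] using this

theorem forall_finset {ι : Type} {R : ι → Set (FreeGroup α) → Prop} (hR : ∀ i, IsLocal (R i))
    (s : Finset ι) : IsLocal fun S => ∀ i ∈ s, R i S := by
  classical
  induction s using Finset.induction_on with
  | empty => simpa using IsLocal.false.not
  | insert i s _ ih =>
    simp only [Finset.mem_insert, forall_eq_or_imp]
    exact (hR i).and ih

theorem forall_finite {ι : Type} [Finite ι] {R : ι → Set (FreeGroup α) → Prop}
    (hR : ∀ i, IsLocal (R i)) : IsLocal fun S => ∀ i, R i S := by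
  have := Fintype.ofFinite ι
  simpa using forall_finset hR Finset.univ

theorem exists_finite {ι : Type} [Finite ι] {R : ι → Set (FreeGroup α) → Prop}
    (hR : ∀ i, IsLocal (R i)) : IsLocal fun S => ∃ i, R i S := by
  have := (IsLocal.forall_finite fun i => (hR i).not).not
  simpa only [not_forall, not_not] using this

theorem const {ι : Type} (p : Prop) : IsLocal (α := ι) fun _ => p := by
  by_cases h : p
  · simpa [h] using IsLocal.false.not
  · simpa [h] using IsLocal.false

theorem isClopen (hP : IsLocal P) {X : Type*} [TopologicalSpace X] (f : X → Set (FreeGroup α))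
    (hf : ∀ w, IsClopen {x | w ∈ f x}) : IsClopen {x | P (f x)} := by
  induction hP with
  | mem w => exact hf w
  | false => simpa using isClopen_empty
  | @imp P Q _ _ hP hQ =>
    have : {x | P (f x) → Q (f x)} = {x | P (f x)}ᶜ ∪ {x | Q (f x)} := by
      ext x
      simp [imp_iff_not_or]
    rw [this]
    exact hP.compl.union hQ

/-- Multiplication, as a symbol of the language of groups. -/
def mulSymbol : groupLanguage.Functions 2 := GroupFunc.mul

/-- Inversion, as a symbol of the language of groups. -/
def invSymbol : groupLanguage.Functions 1 := GroupFunc.inv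

/-- The identity, as a symbol of the language of groups. -/
def oneSymbol : groupLanguage.Functions 0 := GroupFunc.one

/-- The term of the language of groups associated with a list of signed letters. -/
def listTerm {m : ℕ} : List (Fin m × Bool) → groupLanguage.Term (Empty ⊕ Fin m)
  | [] => Term.func oneSymbol Fin.elim0
  | (a, b) :: l => Term.func mulSymbol
      ![bif b then Term.var (Sum.inr a) else Term.func invSymbol ![Term.var (Sum.inr a)],
        listTerm l]

theorem realize_listTerm {m : ℕ} (G : Type u) [Group G] (v : Empty → G) (x : Fin m → G)
    (l : List (Fin m × Bool)) :
    (listTerm l).realize (Sum.elim v x) = FreeGroup.lift x (FreeGroup.mk l) := by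
  induction l with
  | nil =>
    rw [listTerm, Term.realize_func]
    rfl
  | cons a l ih =>
    obtain ⟨a, b⟩ := a
    have h1 : ∀ y : Fin 2 → G, Structure.funMap mulSymbol y = y 0 * y 1 := fun _ => rfl
    have h2 : ∀ y : Fin 1 → G, Structure.funMap invSymbol y = (y 0)⁻¹ := fun _ => rfl
    rw [listTerm, Term.realize_func, h1]
    simp only [Matrix.cons_val_zero, Matrix.cons_val_one, ih]
    cases b <;> simp [h2, FreeGroup.lift_mk]

theorem exists_formula {m : ℕ} {P : Set (FreeGroup (Fin m)) → Prop} (hP : IsLocal P) :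
    ∃ φ : groupLanguage.BoundedFormula Empty m, φ.IsQF ∧
      ∀ (G : Type u) [Group G] (v : Empty → G) (x : Fin m → G),
        φ.Realize v x ↔ P {w | FreeGroup.lift x w = 1} := by
  induction hP with
  | mem w =>
    refine ⟨(listTerm w.toWord).bdEqual (listTerm []),
      (BoundedFormula.IsAtomic.equal _ _).isQF, fun G _ v x => ?_⟩
    rw [BoundedFormula.realize_bdEqual, realize_listTerm, realize_listTerm, FreeGroup.mk_toWord]
    simp [FreeGroup.lift_mk]
  | false => exact ⟨⊥, BoundedFormula.isQF_bot, fun G _ v x => by simp⟩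
  | imp _ _ h1 h2 =>
    obtain ⟨φ, hφ, h1⟩ := h1
    obtain ⟨ψ, hψ, h2⟩ := h2
    exact ⟨φ.imp ψ, hφ.imp hψ, fun G _ v x => by simp [h1, h2]⟩

end IsLocal

theorem isUniversal_alls {m : ℕ} {φ : groupLanguage.BoundedFormula Empty m}
    (hφ : φ.IsUniversal) : BoundedFormula.IsUniversal φ.alls := by
  induction m with
  | zero => exact hφ
  | succ m ih => exact ih hφ.all

/-- All `m`-tuples of elements of `G` satisfy the condition `P` on their relations. -/
def Satisfies (G : Type*) [Group G] {m : ℕ} (P : Set (FreeGroup (Fin m)) → Prop) : Prop :=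
  ∀ x : Fin m → G, P {w | FreeGroup.lift x w = 1}

variable {m : ℕ} {P : Set (FreeGroup (Fin m)) → Prop}

theorem Satisfies.of_injective {G H : Type*} [Group G] [Group H] (h : Satisfies G P)
    (f : H →* G) (hf : Function.Injective f) : Satisfies H P := by
  intro x
  convert h (f ∘ x) using 3 with w
  rw [← map_eq_one_iff f hf]
  have : f.comp (FreeGroup.lift x) = FreeGroup.lift (f ∘ x) := by
    ext i
    simp
  rw [← this]
  rfl

theorem IsLocal.exists_sentence (hP : IsLocal P) :
    ∃ φ : groupLanguage.Sentence, φ.IsUniversal ∧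
      ∀ (G : Type u) [Group G], G ⊨ φ ↔ Satisfies G P := by
  obtain ⟨φ, hφ, h⟩ := hP.exists_formula.{u}
  refine ⟨φ.alls, isUniversal_alls hφ.isUniversal, fun G _ => ?_⟩
  simp only [Sentence.Realize, BoundedFormula.realize_alls, h, Satisfies]

open scoped Classical in
theorem isClopen_mem_ker (n : ℕ) (w : FreeGroup (Fin n)) :
    IsClopen {N : MarkedGroup n | w ∈ N.ker} := by
  have hcont : Continuous fun N : MarkedGroup n => decide (w ∈ N.ker) :=
    (continuous_apply w).comp (continuous_induced_dom (t := Pi.topologicalSpace)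
      (f := fun (N : MarkedGroup n) (w : FreeGroup (Fin n)) => decide (w ∈ N.ker)))
  have := (isClopen_discrete ({true} : Set Bool)).preimage hcont
  simpa [Set.preimage] using this

/-- Tuples in the quotient lift to tuples of words in the free group, an index set that does not
depend on `N`. For a fixed tuple of words the condition involves finitely many memberships in the
kernel, so it is clopen. -/
theorem IsLocal.isClosed_satisfies (hP : IsLocal P) (n : ℕ) :
    IsClosed {N : MarkedGroup n | Satisfies N.group P} := by
  have : {N : MarkedGroup n | Satisfies N.group P} =
      ⋂ y : Fin m → FreeGroup (Fin n), {N | P {w | FreeGroup.lift y w ∈ N.ker}} := by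
    ext N
    have key : ∀ (y : Fin m → FreeGroup (Fin n)) (w : FreeGroup (Fin m)),
        FreeGroup.lift (fun i => (y i : N.group)) w = 1 ↔ FreeGroup.lift y w ∈ N.ker := by
      intro y w
      have : FreeGroup.lift (fun i => (y i : N.group)) =
          (QuotientGroup.mk' N.ker).comp (FreeGroup.lift y) := by
        ext i
        simp
      rw [this]
      simp
    simp only [Set.mem_ofPred_eq, Set.mem_iInter]
    constructor
    · intro h y
      simpa only [key] using h fun i => (y i : N.group)
    · intro h x
      have hx : x = fun i => (((x i).out : FreeGroup (Fin n)) : N.group) := by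
        ext i
        simp
      rw [hx]
      simpa only [key] using h fun i => (x i).out
  rw [this]
  exact isClosed_iInter fun y =>
    (hP.isClopen (fun N : MarkedGroup n => {w | FreeGroup.lift y w ∈ N.ker})
      fun w => isClopen_mem_ker n _).isClosed

theorem IsLocal.satisfies_of_isLimitGroup (hP : IsLocal P) {Γ : Type*} [Group Γ] {G : Type*}
    [Group G] (h : Satisfies Γ P) (hG : IsLimitGroup Γ G) : Satisfies G P := by
  obtain ⟨n, f, hf, hlim⟩ := hG
  have hsub : (Set.range fun φ : FreeGroup (Fin n) →* Γ => MarkedGroup.ofHom φ) ⊆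
      {N : MarkedGroup n | Satisfies N.group P} := by
    rintro _ ⟨φ, rfl⟩
    have h2 : Satisfies (FreeGroup (Fin n) ⧸ φ.ker) P :=
      h.of_injective (QuotientGroup.kerLift φ) (QuotientGroup.kerLift_injective φ)
    exact h2
  have h1 := closure_minimal hsub (hP.isClosed_satisfies n) hlim
  change Satisfies (FreeGroup (Fin n) ⧸ f.ker) P at h1
  exact h1.of_injective (QuotientGroup.quotientKerEquivOfSurjective f hf).symm.toMonoidHom
    (QuotientGroup.quotientKerEquivOfSurjective f hf).symm.injective

end Local

end KCSA

namespace KCSA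

open FirstOrder FirstOrder.Language
open scoped commutatorElement

/-! ### The universal axioms of `K`-CSA groups -/

section Axioms

variable (K : ℕ)

/-- No `n` distinct elements form a set closed under multiplication. -/
def noSubgroupAxiom (n : ℕ) (S : Set (FreeGroup (Fin n))) : Prop :=
  (∀ i j, FreeGroup.of i * (FreeGroup.of j)⁻¹ ∈ S → i = j) →
    ¬ ∀ i j, ∃ k, FreeGroup.of i * FreeGroup.of j * (FreeGroup.of k)⁻¹ ∈ S

/-- The elements `x` for which the `K!`-th powers of `g` and `x * g * x⁻¹` commute form
a subgroup. -/
def subgroupAxiom (S : Set (FreeGroup (Fin 3))) : Prop :=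
  FreeGroup.of 0 ^ K.factorial ∉ S → conjComm (FreeGroup.of 0) (FreeGroup.of 1) K.factorial ∈ S →
    conjComm (FreeGroup.of 0) (FreeGroup.of 2) K.factorial ∈ S →
    conjComm (FreeGroup.of 0) (FreeGroup.of 1 * (FreeGroup.of 2)⁻¹) K.factorial ∈ S

/-- Finitely many elements of this subgroup admit a colouring as in `IsAbelianColouring`. -/
def colouringAxiom (m : ℕ) (S : Set (FreeGroup (Fin (m + 1)))) : Prop :=
  FreeGroup.of 0 ^ K.factorial ∉ S →
    (∀ i : Fin m, conjComm (FreeGroup.of 0) (FreeGroup.of i.succ) K.factorial ∈ S) →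
    ∃ c : Fin m → Fin K, ∀ i j k l, c i = c j → c k = c l →
      ⁅(FreeGroup.of i.succ)⁻¹ * FreeGroup.of j.succ,
        (FreeGroup.of k.succ)⁻¹ * FreeGroup.of l.succ⁆ ∈ S

/-- This subgroup contains all `x` for which the `k`-th powers of `g` and `x * g * x⁻¹` commute. -/
def maximalityAxiom (k : ℕ) (S : Set (FreeGroup (Fin 2))) : Prop :=
  FreeGroup.of 0 ^ K.factorial ∉ S → conjComm (FreeGroup.of 0) (FreeGroup.of 1) k ∈ S →
    conjComm (FreeGroup.of 0) (FreeGroup.of 1) K.factorial ∈ S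

/-- The universal axioms of `K`-CSA groups. -/
inductive KCSAAxiom : (m : ℕ) → (Set (FreeGroup (Fin m)) → Prop) → Prop
  | noSubgroup (n : ℕ) (hn : K < n) : KCSAAxiom n (noSubgroupAxiom n)
  | subgroup : KCSAAxiom 3 (subgroupAxiom K)
  | colouring (m : ℕ) : KCSAAxiom (m + 1) (colouringAxiom K m)
  | maximality (k : ℕ) (hk : 0 < k) : KCSAAxiom 2 (maximalityAxiom K k)

variable {K}

theorem KCSAAxiom.isLocal {m : ℕ} {P : Set (FreeGroup (Fin m)) → Prop} (h : KCSAAxiom K m P) :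
    IsLocal P := by
  cases h with
  | noSubgroup n hn =>
    exact (IsLocal.forall_finite fun i => IsLocal.forall_finite fun j =>
      (IsLocal.mem _).imp (IsLocal.const _)).imp (IsLocal.forall_finite fun i =>
        IsLocal.forall_finite fun j => IsLocal.exists_finite fun k => IsLocal.mem _).not
  | subgroup => exact (IsLocal.mem _).not.imp ((IsLocal.mem _).imp ((IsLocal.mem _).imp (.mem _)))
  | colouring m =>
    exact (IsLocal.mem _).not.imp ((IsLocal.forall_finite fun i => IsLocal.mem _).imp
      (IsLocal.exists_finite fun c => IsLocal.forall_finite fun i => IsLocal.forall_finite fun j =>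
        IsLocal.forall_finite fun k => IsLocal.forall_finite fun l => (IsLocal.const _).imp
          ((IsLocal.const _).imp (.mem _))))
  | maximality k hk => exact (IsLocal.mem _).not.imp ((IsLocal.mem _).imp (.mem _))

variable {G : Type*} [Group G]

theorem satisfies_noSubgroupAxiom {n : ℕ} : Satisfies G (noSubgroupAxiom n) ↔
    ∀ x : Fin n → G, Function.Injective x → ¬ ∀ i j, ∃ k, x i * x j = x k := by
  simp [Satisfies, noSubgroupAxiom, mul_inv_eq_one, Function.Injective]

theorem satisfies_subgroupAxiom : Satisfies G (subgroupAxiom K) ↔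
    ∀ g x y : G, g ^ K.factorial ≠ 1 → conjComm g x K.factorial = 1 →
      conjComm g y K.factorial = 1 → conjComm g (x * y⁻¹) K.factorial = 1 := by
  simp only [Satisfies, subgroupAxiom, Set.mem_ofPred_eq, map_pow, FreeGroup.lift_apply_of,
    map_conjComm, map_mul, map_inv]
  exact ⟨fun h g x y => h ![g, x, y], fun h x => h _ _ _⟩

theorem satisfies_colouringAxiom {m : ℕ} : Satisfies G (colouringAxiom K m) ↔
    ∀ (g : G) (x : Fin m → G), g ^ K.factorial ≠ 1 → (∀ i, conjComm g (x i) K.factorial = 1) →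
      ∃ c : Fin m → Fin K, IsAbelianColouring K x c := by
  simp only [Satisfies, colouringAxiom, Set.mem_ofPred_eq, map_pow, FreeGroup.lift_apply_of,
    map_conjComm, map_mul, map_inv, map_commutatorElement, IsAbelianColouring]
  exact ⟨fun h g x => h (Fin.cons g x), fun h x => h _ _⟩

theorem satisfies_maximalityAxiom {k : ℕ} : Satisfies G (maximalityAxiom K k) ↔
    ∀ g x : G, g ^ K.factorial ≠ 1 → conjComm g x k = 1 → conjComm g x K.factorial = 1 := by
  simp only [Satisfies, maximalityAxiom, Set.mem_ofPred_eq, map_pow, FreeGroup.lift_apply_of,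
    map_conjComm]
  exact ⟨fun h g x => h ![g, x], fun h x => h _ _⟩

/-- Compactness for colourings. -/
theorem exists_colouring_of_finite (hK : 0 < K)
    (h : ∀ (m : ℕ) (x : Fin m → G), ∃ c : Fin m → Fin K, IsAbelianColouring K x c) :
    ∃ c : G → Fin K, IsAbelianColouring K id c := by
  classical
  have h' : ∀ s : Finset G, ∃ c : G → Fin K, ∀ x ∈ s, ∀ y ∈ s, ∀ z ∈ s, ∀ w ∈ s,
      c x = c y → c z = c w → ⁅x⁻¹ * y, z⁻¹ * w⁆ = 1 := by
    intro s
    obtain ⟨c, hc⟩ := h s.card fun i => (s.equivFin.symm i : G)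
    refine ⟨fun x => if hx : x ∈ s then c (s.equivFin ⟨x, hx⟩) else ⟨0, hK⟩, ?_⟩
    intro x hx y hy z hz w hw hxy hzw
    simp only [hx, hy, hz, hw, dif_pos] at hxy hzw
    simpa using hc _ _ _ _ hxy hzw
  choose g hg using h'
  -- Rado selection: on each finite set, `c` agrees with the colouring chosen for some larger finite
  -- set. The condition involves only four points at a time.
  obtain ⟨c, hc⟩ := Finset.rado_selection g
  refine ⟨c, fun x y z w hxy hzw => ?_⟩
  obtain ⟨t, hst, ht⟩ := hc {x, y, z, w}
  have hx := ht x (by simp)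
  have hy := ht y (by simp)
  have hz := ht z (by simp)
  have hw := ht w (by simp)
  refine hg t x (hst (by simp)) y (hst (by simp)) z (hst (by simp)) w (hst (by simp)) ?_ ?_
  · rw [← hx, ← hy, hxy]
  · rw [← hz, ← hw, hzw]

theorem IsKCSA.satisfies (h : IsKCSA K G) {m : ℕ} {P : Set (FreeGroup (Fin m)) → Prop}
    (hP : KCSAAxiom K m P) : Satisfies G P := by
  have hinf : ∀ g : G, g ^ K.factorial ≠ 1 → ∃ M : Subgroup G, IsKVirtuallyAbelian K M ∧
      (∀ x, x ∈ M ↔ conjComm g x K.factorial = 1) ∧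
      ∀ x k, 0 < k → conjComm g x k = 1 → x ∈ M := by
    intro g hg
    have hg : ¬ IsOfFinOrder g := by rwa [h.isOfFinOrder_iff]
    obtain ⟨M, ⟨hM, hgM⟩, -⟩ := h.existsUnique_maximal g hg
    exact ⟨M, h.isKVirtuallyAbelian g hg M hM hgM, fun x => h.mem_iff hM hg hgM,
      fun x k hk hx => h.mem_of_conjComm_eq_one hM hg hgM hk hx⟩
  cases hP with
  | noSubgroup n hn =>
    refine satisfies_noSubgroupAxiom.2 fun x hx hmul => ?_
    have hne : Nonempty (Fin m) := ⟨⟨0, by omega⟩⟩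
    choose f hf using hmul
    have hfin : (Set.range x).Finite := Set.finite_range x
    have hpow : ∀ (i : Fin m) (k : ℕ), x i ^ (k + 1) ∈ Set.range x := by
      intro i k
      induction k with
      | zero => simp
      | succ k ih =>
        obtain ⟨j, hj⟩ := ih
        rw [pow_succ, ← hj, hf]
        exact ⟨_, rfl⟩
    have hord : ∀ i, IsOfFinOrder (x i) := by
      intro i
      rw [← finite_powers]
      refine (hfin.union (Set.finite_singleton 1)).subset ?_
      rintro _ ⟨k, rfl⟩
      rcases k with _ | k
      · simp
      · exact Or.inl (hpow i k)
    have hone : ∀ i, ∃ j, x j = (x i)⁻¹ := by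
      intro i
      have h1 := pow_orderOf_eq_one (x i)
      have h2 := (hord i).orderOf_pos
      -- The inverse as a power with positive exponent, here twice the order minus one; the order
      -- minus one would give exponent `0` for the identity.
      obtain ⟨j, hj⟩ := hpow i (2 * orderOf (x i) - 2)
      refine ⟨j, ?_⟩
      rw [hj, eq_inv_iff_mul_eq_one, ← pow_succ,
        show 2 * orderOf (x i) - 2 + 1 + 1 = orderOf (x i) * 2 by omega, pow_mul, h1, one_pow]
    let F : Subgroup G :=
      { carrier := Set.range x
        mul_mem' := by
          rintro _ _ ⟨i, rfl⟩ ⟨j, rfl⟩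
          exact ⟨_, (hf i j).symm⟩
        one_mem' := by
          obtain ⟨i⟩ := hne
          obtain ⟨j, hj⟩ := hone i
          exact ⟨f i j, by rw [← hf, hj, mul_inv_cancel]⟩
        inv_mem' := by
          rintro _ ⟨i, rfl⟩
          exact hone i }
    have hF : Nat.card F = m := by
      have : Nat.card (Set.range x) = m := by
        rw [Nat.card_congr (Equiv.ofInjective x hx).symm]
        simp
      exact this
    have := h.card_le F hfin
    omega
  | subgroup =>
    refine satisfies_subgroupAxiom.2 fun g x y hg => ?_
    obtain ⟨M, -, hM, -⟩ := hinf g hg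
    simp only [← hM]
    exact fun hx hy => M.mul_mem hx (M.inv_mem hy)
  | colouring m =>
    refine satisfies_colouringAxiom.2 fun g x hg hx => ?_
    obtain ⟨M, hK, hM, -⟩ := hinf g hg
    simp only [← hM] at hx
    obtain ⟨c, hc⟩ := isKVirtuallyAbelian_iff_colouring.1 hK
    refine ⟨fun i => c ⟨x i, hx i⟩, fun i j k l hij hkl => ?_⟩
    simpa [commutatorElement_def] using congrArg Subtype.val (hc _ _ _ _ hij hkl)
  | maximality k hk =>
    refine satisfies_maximalityAxiom.2 fun g x hg hx => ?_
    obtain ⟨M, -, hM, hmax⟩ := hinf g hg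
    exact (hM x).1 (hmax x k hk hx)

theorem isKCSA_of_satisfies (hK : 0 < K)
    (h : ∀ (m : ℕ) (P : Set (FreeGroup (Fin m)) → Prop), KCSAAxiom K m P → Satisfies G P) :
    IsKCSA K G := by
  refine IsKCSA.of_subgroups (fun F hF => ?_) fun g hg => ?_
  · by_contra! hlt
    refine satisfies_noSubgroupAxiom.1 (h _ _ (.noSubgroup _ hlt))
      (fun i => ((Finite.equivFin F).symm i : G))
      (Subtype.val_injective.comp (Finite.equivFin F).symm.injective) fun i j => ?_
    exact ⟨Finite.equivFin F ((Finite.equivFin F).symm i * (Finite.equivFin F).symm j), by simp⟩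
  · have hg' : g ^ K.factorial ≠ 1 := fun h1 =>
      hg (isOfFinOrder_iff_pow_eq_one.2 ⟨_, K.factorial_pos, h1⟩)
    have hsub := satisfies_subgroupAxiom.1 (h _ _ .subgroup) g
    have hone : conjComm g 1 K.factorial = 1 := by simp [conjComm]
    have hinv : ∀ x, conjComm g x K.factorial = 1 → conjComm g x⁻¹ K.factorial = 1 := by
      intro x hx
      simpa using hsub 1 x hg' hone hx
    -- The candidate for `M(g)`: the subgroup axiom makes it a subgroup, the colouring axioms make
    -- it `K`-virtually abelian, and the maximality axioms give the remaining hypothesis of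
    -- `IsKCSA.of_subgroups`.
    let E : Subgroup G :=
      { carrier := {x | conjComm g x K.factorial = 1}
        mul_mem' := by
          intro x y hx hy
          simpa using hsub x y⁻¹ hg' hx (hinv y hy)
        one_mem' := hone
        inv_mem' := fun {x} => hinv x }
    refine ⟨E, isKVirtuallyAbelian_iff_colouring.2 (exists_colouring_of_finite hK ?_), ?_⟩
    · intro m x
      obtain ⟨c, hc⟩ := satisfies_colouringAxiom.1 (h _ _ (.colouring m)) g (fun i => x i) hg'
        fun i => (x i).2
      refine ⟨c, fun i j k l hij hkl => Subtype.val_injective ?_⟩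
      simpa [commutatorElement_def] using hc i j k l hij hkl
    · intro x k hk hx
      exact satisfies_maximalityAxiom.1 (h _ _ (.maximality k hk)) g x hg' hx

theorem isKCSA_iff_satisfies (hK : 0 < K) : IsKCSA K G ↔
    ∀ (m : ℕ) (P : Set (FreeGroup (Fin m)) → Prop), KCSAAxiom K m P → Satisfies G P :=
  ⟨fun h _ _ hP => h.satisfies hP, isKCSA_of_satisfies hK⟩

theorem IsKCSA.of_injective (hK : 0 < K) {H : Type*} [Group H] (h : IsKCSA K G) (f : H →* G)
    (hf : Function.Injective f) : IsKCSA K H :=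
  isKCSA_of_satisfies hK fun _ _ hP => (h.satisfies hP).of_injective f hf

theorem IsKCSA.of_isLimitGroup (hK : 0 < K) {Γ : Type*} [Group Γ] (h : IsKCSA K Γ)
    (hG : IsLimitGroup Γ G) : IsKCSA K G :=
  isKCSA_of_satisfies hK fun _ _ hP => hP.isLocal.satisfies_of_isLimitGroup (h.satisfies hP) hG

theorem isClosed_isKCSA (hK : 0 < K) (n : ℕ) :
    IsClosed {N : MarkedGroup n | IsKCSA K N.group} := by
  simp only [isKCSA_iff_satisfies hK, Set.ofPred_forall]
  exact isClosed_iInter fun m => isClosed_iInter fun P => isClosed_iInter fun hP =>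
    hP.isLocal.isClosed_satisfies n

theorem exists_universal_theory (hK : 0 < K) :
    ∃ T : groupLanguage.Theory, (∀ φ ∈ T, φ.IsUniversal) ∧
      ∀ (G : Type u) [Group G], IsKCSA K G ↔ G ⊨ T := by
  refine ⟨{φ | φ.IsUniversal ∧ ∃ (m : ℕ) (P : Set (FreeGroup (Fin m)) → Prop), KCSAAxiom K m P ∧
    ∀ (G : Type u) [Group G], G ⊨ φ ↔ Satisfies G P}, fun φ hφ => hφ.1, fun G _ => ?_⟩
  rw [isKCSA_iff_satisfies hK, Theory.model_iff]
  constructor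
  · rintro h φ ⟨-, m, P, hP, hφ⟩
    exact (hφ G).2 (h m P hP)
  · intro h m P hP
    obtain ⟨φ, hφ, hφP⟩ := hP.isLocal.exists_sentence.{u}
    exact (hφP G).1 (h φ ⟨hφ, m, P, hP, hφP⟩)

end Axioms

end KCSA

namespace KCSA

/-! ### Groups with a hyperbolic length function -/

/-- A length function on a group whose left-invariant metric is proper, geodesic (in the discrete
sense) and hyperbolic. -/
structure IsHyperbolicLength {G : Type*} [Group G] (ℓ : G → ℤ) (D : ℤ) : Prop where
  one : ℓ 1 = 0
  inv : ∀ x, ℓ x⁻¹ = ℓ x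
  mul_le : ∀ x y, ℓ (x * y) ≤ ℓ x + ℓ y
  finite_ball : ∀ n, {x | ℓ x ≤ n}.Finite
  geodesic : ∀ x r, 0 ≤ r → r ≤ ℓ x → ∃ p, ℓ p = r ∧ ℓ (p⁻¹ * x) = ℓ x - r
  four_point : ∀ x y z w, ℓ (x⁻¹ * y) + ℓ (z⁻¹ * w) ≤
    max (ℓ (x⁻¹ * z) + ℓ (y⁻¹ * w)) (ℓ (x⁻¹ * w) + ℓ (y⁻¹ * z)) + D

/-- The left-invariant distance of a length function. -/
def ldist {G : Type*} [Group G] (ℓ : G → ℤ) (x y : G) : ℤ := ℓ (x⁻¹ * y)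

/-- Twice the Gromov product of `x` and `y` based at `p`. -/
def gprod {G : Type*} [Group G] (ℓ : G → ℤ) (x y p : G) : ℤ :=
  ldist ℓ p x + ldist ℓ p y - ldist ℓ x y

namespace IsHyperbolicLength

variable {G : Type*} [Group G] {ℓ : G → ℤ} {D : ℤ}

section Basic

variable (h : IsHyperbolicLength ℓ D)
include h

theorem nonneg (x : G) : 0 ≤ ℓ x := by
  have := h.mul_le x x⁻¹
  rw [mul_inv_cancel, h.one, h.inv] at this
  omega

theorem dist_comm (x y : G) : ldist ℓ x y = ldist ℓ y x := by
  rw [ldist, ← h.inv]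
  simp [ldist]

theorem dist_self (x : G) : ldist ℓ x x = 0 := by simp [ldist, h.one]

omit h in
theorem one_dist (x : G) : ldist ℓ 1 x = ℓ x := by simp [ldist]

theorem dist_one (x : G) : ldist ℓ x 1 = ℓ x := by rw [h.dist_comm, one_dist]

omit h in
theorem dist_mul_left (g x y : G) : ldist ℓ (g * x) (g * y) = ldist ℓ x y := by
  simp [ldist, mul_assoc]

theorem dist_triangle (x y z : G) : ldist ℓ x z ≤ ldist ℓ x y + ldist ℓ y z := by
  have := h.mul_le (x⁻¹ * y) (y⁻¹ * z)
  simpa [ldist, mul_assoc] using this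

theorem const_nonneg : 0 ≤ D := by
  have := h.four_point 1 1 1 1
  simpa [h.one] using this

theorem four_point' (x y z w : G) :
    ldist ℓ x y + ldist ℓ z w ≤ ldist ℓ x z + ldist ℓ y w + D ∨
      ldist ℓ x y + ldist ℓ z w ≤ ldist ℓ x w + ldist ℓ y z + D := by
  have := h.four_point x y z w
  simp only [ldist]
  omega

theorem gprod_comm (x y p : G) : gprod ℓ x y p = gprod ℓ y x p := by
  have := h.dist_comm x y
  simp only [gprod]
  omega

omit h in
theorem gprod_mul_left (g x y p : G) : gprod ℓ (g * x) (g * y) (g * p) = gprod ℓ x y p := by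
  simp [gprod, dist_mul_left]

theorem gprod_nonneg (x y p : G) : 0 ≤ gprod ℓ x y p := by
  have := h.dist_triangle x p y
  have := h.dist_comm x p
  simp only [gprod]
  omega

theorem gprod_add_gprod (x y p : G) : gprod ℓ x y p + gprod ℓ p y x = 2 * ldist ℓ p x := by
  have := h.dist_comm p x
  simp only [gprod]
  omega

theorem gprod_le_add_dist (x y z p : G) : gprod ℓ x y p ≤ gprod ℓ x z p + 2 * ldist ℓ y z := by
  have := h.dist_triangle p z y
  have := h.dist_triangle x y z
  have := h.dist_comm y z
  simp only [gprod]
  omega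

theorem le_gprod (x y p : G) : 2 * ldist ℓ p x - 2 * ldist ℓ x y ≤ gprod ℓ x y p := by
  have := h.dist_triangle p y x
  have := h.dist_comm x y
  simp only [gprod]
  omega

theorem min_gprod_le (x y z p : G) :
    gprod ℓ x z p ≤ gprod ℓ x y p + D ∨ gprod ℓ z y p ≤ gprod ℓ x y p + D := by
  have := h.four_point' x y z p
  have := h.dist_comm p x
  have := h.dist_comm p y
  have := h.dist_comm p z
  have := h.dist_comm z y
  simp only [gprod]
  omega

/-- If `x` is close to `y` seen from `p`, then so are `x` and `z` whenever `y` and `z` are. -/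
theorem gprod_le_of_lt {x y z p : G} {c : ℤ} (h1 : gprod ℓ x y p ≤ c)
    (h2 : c + D < gprod ℓ z y p) : gprod ℓ x z p ≤ c + D := by
  have := h.min_gprod_le x y z p
  omega

omit h in
theorem gprod_one_one (x y : G) : gprod ℓ x y 1 = ℓ x + ℓ y - ℓ (x⁻¹ * y) := by
  simp [gprod, ldist]

end Basic

/-! ### Local-to-global growth and an analogue of Serre's lemma -/

section Growth

variable (h : IsHyperbolicLength ℓ D)
include h

/-- Discrete local-to-global principle. Apply the four-point condition to `x 0`, `x (n + 1)`, `x n`,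
`x (n + 2)`: one alternative would make `x (n + 1)` closer to `x 0` than `x n`, against the
induction hypothesis, and the other is the claim. -/
theorem dist_add_le_of_local {x : ℕ → G} {a : ℤ} (ha : 0 < a)
    (h1 : ∀ n, ldist ℓ (x n) (x (n + 1)) + D + a ≤ ldist ℓ (x n) (x (n + 2)))
    (h2 : ∀ n, ldist ℓ (x (n + 1)) (x (n + 2)) + D + a ≤ ldist ℓ (x n) (x (n + 2))) (n : ℕ) :
    ldist ℓ (x 0) (x n) + a ≤ ldist ℓ (x 0) (x (n + 1)) := by
  have hD := h.const_nonneg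
  induction n with
  | zero =>
    have := h2 0
    have := h.dist_triangle (x 0) (x 1) (x 2)
    have := h.dist_self (x 0)
    simp only [zero_add] at *
    omega
  | succ n ih =>
    have := h.four_point' (x 0) (x (n + 1)) (x n) (x (n + 2))
    have := h1 n
    have := h2 n
    have := h.dist_comm (x n) (x (n + 1))
    rw [show n + 1 + 1 = n + 2 from rfl]
    omega

theorem mul_le_dist_of_local {x : ℕ → G} {a : ℤ} (ha : 0 < a)
    (h1 : ∀ n, ldist ℓ (x n) (x (n + 1)) + D + a ≤ ldist ℓ (x n) (x (n + 2)))
    (h2 : ∀ n, ldist ℓ (x (n + 1)) (x (n + 2)) + D + a ≤ ldist ℓ (x n) (x (n + 2))) (n : ℕ) :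
    a * n ≤ ldist ℓ (x 0) (x n) := by
  induction n with
  | zero => simp [h.dist_self]
  | succ n ih =>
    have := h.dist_add_le_of_local ha h1 h2 n
    push_cast
    linarith

theorem length_pow_add_le {u : G} {a : ℤ} (ha : 0 < a) (hu : ℓ u + D + a ≤ ℓ (u ^ 2)) (n : ℕ) :
    ℓ (u ^ n) + a ≤ ℓ (u ^ (n + 1)) := by
  have h1 : ∀ n : ℕ, ldist ℓ (u ^ n) (u ^ (n + 1)) = ℓ u := fun n => by simp [ldist, pow_succ]
  have h2 : ∀ n : ℕ, ldist ℓ (u ^ n) (u ^ (n + 2)) = ℓ (u ^ 2) := fun n => by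
    simp [ldist, pow_add]
  have := h.dist_add_le_of_local (x := fun n => u ^ n) ha
    (fun n => by rw [h1, h2]; exact hu) (fun n => by rw [h1 (n + 1), h2]; exact hu) n
  simpa [ldist] using this

theorem mul_le_length_pow {u : G} {a : ℤ} (ha : 0 < a) (hu : ℓ u + D + a ≤ ℓ (u ^ 2)) (n : ℕ) :
    a * n ≤ ℓ (u ^ n) := by
  induction n with
  | zero => simp [h.one]
  | succ n ih =>
    have := h.length_pow_add_le ha hu n
    push_cast
    linarith

theorem mul_le_length_mul_pow {s t : G} {a : ℤ} (ha : 0 < a)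
    (h1 : ℓ s + D + a ≤ ℓ (s * t)) (h2 : ℓ t + D + a ≤ ℓ (s * t))
    (h3 : ℓ s + D + a ≤ ℓ (t * s)) (h4 : ℓ t + D + a ≤ ℓ (t * s)) (n : ℕ) :
    a * n ≤ ℓ ((s * t) ^ n) := by
  -- The path `1, s, st, sts, …`, whose two-step displacements are alternately those of `s * t` and
  -- `t * s`.
  let x : ℕ → G := fun n => (s * t) ^ (n / 2) * if n % 2 = 0 then 1 else s
  have hx0 : ∀ m, x (2 * m) = (s * t) ^ m := fun m => by simp [x]
  have hx1 : ∀ m, x (2 * m + 1) = (s * t) ^ m * s := fun m => by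
    have e1 : (2 * m + 1) / 2 = m := by omega
    simp [x, e1]
  have key : ∀ m : ℕ, (ldist ℓ (x (2 * m)) (x (2 * m + 1)) = ℓ s ∧
      ldist ℓ (x (2 * m + 1)) (x (2 * m + 2)) = ℓ t ∧
      ldist ℓ (x (2 * m)) (x (2 * m + 2)) = ℓ (s * t) ∧
      ldist ℓ (x (2 * m + 2)) (x (2 * m + 3)) = ℓ s ∧
      ldist ℓ (x (2 * m + 1)) (x (2 * m + 3)) = ℓ (t * s)) := by
    intro m
    rw [show 2 * m + 2 = 2 * (m + 1) by ring, show 2 * m + 3 = 2 * (m + 1) + 1 by ring]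
    simp only [hx0, hx1, ldist, pow_succ]
    refine ⟨?_, ?_, ?_, ?_, ?_⟩ <;> congr 1 <;> group
  have := h.mul_le_dist_of_local (x := x) ha (fun n => ?_) (fun n => ?_) (2 * n)
  · rw [hx0, show x 0 = 1 by simp [x], one_dist] at this
    push_cast at this
    nlinarith
  · obtain ⟨m, rfl | rfl⟩ := Nat.even_or_odd' n
    · obtain ⟨e1, e2, e3, e4, e5⟩ := key m
      rw [e1, e3]
      exact h1
    · obtain ⟨e1, e2, e3, e4, e5⟩ := key m
      change ldist ℓ (x (2 * m + 1)) (x (2 * m + 2)) + D + a ≤ ldist ℓ (x (2 * m + 1)) (x (2 * m + 3))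
      rw [e2, e5]
      exact h4
  · obtain ⟨m, rfl | rfl⟩ := Nat.even_or_odd' n
    · obtain ⟨e1, e2, e3, e4, e5⟩ := key m
      rw [e2, e3]
      exact h2
    · obtain ⟨e1, e2, e3, e4, e5⟩ := key m
      change ldist ℓ (x (2 * m + 2)) (x (2 * m + 3)) + D + a ≤ ldist ℓ (x (2 * m + 1)) (x (2 * m + 3))
      rw [e4, e5]
      exact h3

/-- Moving the base point along a geodesic to `s` decreases the displacement of `t`. -/
theorem length_conj_le {s t p : G} {r : ℤ} (hp : ℓ p = r) (hps : ℓ (p⁻¹ * s) = ℓ s - r)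
    (h1 : 2 * r ≤ gprod ℓ s t 1) (h2 : 2 * r ≤ gprod ℓ s t⁻¹ 1) :
    ℓ (p⁻¹ * t * p) ≤ 2 * r - ℓ t + D ∨ ℓ (p⁻¹ * t * p) ≤ ℓ t - 2 * r + 3 * D := by
  have hs : gprod ℓ p s 1 = 2 * r := by
    rw [gprod_one_one (ℓ := ℓ), hp, hps]
    ring
  have e1 := h.min_gprod_le p t s 1
  have e2 := h.min_gprod_le p t⁻¹ s 1
  have e3 := h.four_point' p (t * p) 1 t
  have e4 : ldist ℓ p t⁻¹ = ldist ℓ (t * p) 1 := by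
    rw [← dist_mul_left t p t⁻¹, mul_inv_cancel]
  have e5 : ldist ℓ (t * p) t = ℓ p := by
    rw [h.dist_comm]
    simp [ldist]
  have e6 : ldist ℓ p (t * p) = ℓ (p⁻¹ * t * p) := by simp [ldist, mul_assoc]
  have e7 := h.inv t
  simp only [gprod, one_dist, h.dist_one] at *
  omega

/-- If `s`, `t` and `s * t` do not grow, the pairs `s, s⁻¹` and `t, t⁻¹`, and one of the pairs `s⁻¹,
t` and `t⁻¹, s`, have large Gromov products. Hyperbolicity, used twice, gives large products of `s`
with both `t` and `t⁻¹`, so moving the base point towards `s` shortens `t`. When `t` is much shorter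
than `L`, the triangle inequality suffices. -/
theorem length_conj_lt {s t p : G} {a L : ℤ} (ha : 0 < a) (hL : 11 * D + 4 + a < L)
    (hs : ℓ s = L) (ht : ℓ t ≤ L) (hp : ℓ p = 2 * D + 1)
    (hps : ℓ (p⁻¹ * s) = ℓ s - (2 * D + 1))
    (ns : ¬ ∀ k : ℕ, a * k ≤ ℓ (s ^ k)) (nt : ¬ ∀ k : ℕ, a * k ≤ ℓ (t ^ k))
    (nst : ¬ ∀ k : ℕ, a * k ≤ ℓ ((s * t) ^ k)) : ℓ (p⁻¹ * t * p) < L := by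
  have hD := h.const_nonneg
  by_cases hlt : ℓ t + 2 * (2 * D + 1) < L
  · have := h.mul_le (p⁻¹ * t) p
    have := h.mul_le p⁻¹ t
    have := h.inv p
    omega
  have ns' : ℓ (s * s) < ℓ s + D + a := by
    by_contra! hc
    exact ns (h.mul_le_length_pow ha (by rwa [pow_two]))
  have nt' : ℓ (t * t) < ℓ t + D + a := by
    by_contra! hc
    exact nt (h.mul_le_length_pow ha (by rwa [pow_two]))
  have nst' : ℓ (s * t) < ℓ s + D + a ∨ ℓ (s * t) < ℓ t + D + a ∨ ℓ (t * s) < ℓ s + D + a ∨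
      ℓ (t * s) < ℓ t + D + a := by
    by_contra! hc
    exact nst (h.mul_le_length_mul_pow ha hc.1 hc.2.1 hc.2.2.1 hc.2.2.2)
  have es := gprod_one_one (ℓ := ℓ) s⁻¹ s
  have et := gprod_one_one (ℓ := ℓ) t⁻¹ t
  have est := gprod_one_one (ℓ := ℓ) s⁻¹ t
  have ets := gprod_one_one (ℓ := ℓ) t⁻¹ s
  simp only [inv_inv, h.inv] at es et est ets
  have c1 := h.gprod_comm s⁻¹ s 1
  have c2 := h.gprod_comm t⁻¹ s 1
  have c3 := h.gprod_comm t⁻¹ t 1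
  have m1 := h.min_gprod_le s t s⁻¹ 1
  have m2 := h.min_gprod_le s t⁻¹ t 1
  have m3 := h.min_gprod_le s t t⁻¹ 1
  have := h.length_conj_le (r := 2 * D + 1) hp hps (t := t) (by omega) (by omega)
  omega

/-- An analogue of Serre's lemma: in a large enough finite set, some element, or the product of two
elements, is hyperbolic. -/
theorem exists_growth {a : ℤ} (ha : 0 < a) : ∃ K : ℕ, ∀ X : Finset G, K < X.card →
    ∃ u, (u ∈ X ∨ ∃ x ∈ X, ∃ y ∈ X, u = x * y) ∧
      ∃ y, ∀ k : ℕ, a * k ≤ ℓ (y⁻¹ * u ^ k * y) := by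
  classical
  have hD := h.const_nonneg
  refine ⟨(h.finite_ball (11 * D + 4 + a)).toFinset.card, fun X hX => ?_⟩
  by_contra! hno
  have hno' : ∀ u, (u ∈ X ∨ ∃ x ∈ X, ∃ y ∈ X, u = x * y) → ∀ y : G,
      ¬ ∀ k : ℕ, a * k ≤ ℓ ((y⁻¹ * u * y) ^ k) := by
    intro u hu y hk
    obtain ⟨k, hk'⟩ := hno u hu y
    have := hk k
    have e : (y⁻¹ * u * y) ^ k = y⁻¹ * u ^ k * y := by
      simpa using conj_pow (i := k) (a := y⁻¹) (b := u)
    rw [e] at this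
    omega
  let f : G → ℕ := fun y => X.sup fun x => (ℓ (y⁻¹ * x * y)).toNat
  -- A base point minimizing the largest displacement. If that displacement is small, conjugation by
  -- `y` embeds `X` into a fixed ball; otherwise the base point can be improved by `length_conj_lt`.
  set y := Function.argmin f with hy
  have hmin : ∀ z, f y ≤ f z := fun z => Function.argmin_le f z
  have hne : X.Nonempty := Finset.card_pos.1 (by omega)
  obtain ⟨s, hsX, hs⟩ := Finset.exists_mem_eq_sup X hne fun x => (ℓ (y⁻¹ * x * y)).toNat
  have hle : ∀ x ∈ X, ℓ (y⁻¹ * x * y) ≤ ℓ (y⁻¹ * s * y) := by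
    intro x hx
    have : (ℓ (y⁻¹ * x * y)).toNat ≤ (ℓ (y⁻¹ * s * y)).toNat :=
      (Finset.le_sup (f := fun x => (ℓ (y⁻¹ * x * y)).toNat) hx).trans_eq hs
    have := h.nonneg (y⁻¹ * x * y)
    have := h.nonneg (y⁻¹ * s * y)
    omega
  by_cases hC : ℓ (y⁻¹ * s * y) ≤ 11 * D + 4 + a
  · refine hX.not_ge (Finset.card_le_card_of_injOn (fun x => y⁻¹ * x * y) ?_ ?_)
    · intro x hx
      simpa using (hle x hx).trans hC
    · intro x _ x' _ hxx
      simpa using hxx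
  · obtain ⟨p, hp, hps⟩ := h.geodesic (y⁻¹ * s * y) (2 * D + 1) (by omega) (by omega)
    have hlt : f (y * p) < f y := by
      have hfy : f y = (ℓ (y⁻¹ * s * y)).toNat := hs
      rw [hfy]
      refine (Finset.sup_lt_iff (by simp; omega)).2 fun x hx => ?_
      have := h.length_conj_lt (s := y⁻¹ * s * y) (t := y⁻¹ * x * y) (p := p) ha
        (by omega) rfl (hle x hx) hp hps (hno' s (Or.inl hsX) y) (hno' x (Or.inl hx) y) (by
          have := hno' (s * x) (Or.inr ⟨s, hsX, x, hx, rfl⟩) y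
          rwa [show y⁻¹ * (s * x) * y = y⁻¹ * s * y * (y⁻¹ * x * y) by group] at this)
      have e : (y * p)⁻¹ * x * (y * p) = p⁻¹ * (y⁻¹ * x * y) * p := by group
      rw [e]
      have := h.nonneg (p⁻¹ * (y⁻¹ * x * y) * p)
      omega
    exact (hmin _).not_gt hlt

end Growth

end IsHyperbolicLength

end KCSA

namespace KCSA

namespace IsHyperbolicLength

variable {G : Type*} [Group G] {ℓ : G → ℤ} {D : ℤ}

/-! ### Elements with a quasi-axis -/

section Axis

variable (h : IsHyperbolicLength ℓ D)
include h

/-- Were the square shorter, `u` and `u⁻¹` would have a long common beginning, and conjugating by an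
initial piece of length `2 * D + 1` would shorten `u`. -/
theorem length_sq_of_conj_minimal {u : G} (hmin : ∀ x, ℓ u ≤ ℓ (x⁻¹ * u * x))
    (hu : 3 * D + 2 ≤ ℓ u) : 2 * ℓ u - (4 * D + 2) ≤ ℓ (u ^ 2) := by
  have hD := h.const_nonneg
  by_contra! hlt
  obtain ⟨p, hp, hps⟩ := h.geodesic u (2 * D + 1) (by omega) (by omega)
  have e1 : gprod ℓ u u⁻¹ 1 = 2 * ℓ u - ℓ (u ^ 2) := by
    rw [h.gprod_comm, gprod_one_one, h.inv, inv_inv, pow_two]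
    ring
  have e2 : gprod ℓ u u 1 = 2 * ℓ u := by
    rw [gprod_one_one, inv_mul_cancel, h.one]
    ring
  have := h.length_conj_le hp hps (t := u) (by omega) (by omega)
  have := hmin p
  omega

end Axis

/-- The powers of `u` are almost aligned. -/
def IsAxial (ℓ : G → ℤ) (e : ℤ) (u : G) : Prop :=
  ∀ m n : ℕ, ℓ (u ^ m) + ℓ (u ^ n) ≤ ℓ (u ^ (m + n)) + e

section Axis

variable (h : IsHyperbolicLength ℓ D)
include h

/-- Growth of the powers shows that `u ^ (n + 1)` starts along `u` and the inverse powers along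
`u⁻¹`. The product of `u⁻¹` and `u` is at most `4 * D + 2`; replacing each of the two by its powers
costs one `D`. -/
theorem isAxial_of_length_sq {u : G} (hsq : 2 * ℓ u - (4 * D + 2) ≤ ℓ (u ^ 2))
    (hu : 6 * D + 3 ≤ ℓ u) : IsAxial ℓ (6 * D + 2) u := by
  have hD := h.const_nonneg
  have hgrow : ∀ n, ℓ (u ^ n) + (ℓ u - 5 * D - 2) ≤ ℓ (u ^ (n + 1)) :=
    h.length_pow_add_le (by omega) (by omega)
  have key : ∀ (v : G) (n : ℕ), gprod ℓ (v ^ (n + 1)) v 1 = ℓ (v ^ (n + 1)) + ℓ v - ℓ (v ^ n) := by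
    intro v n
    rw [gprod_one_one, ← h.inv (_⁻¹ * _)]
    congr 2
    rw [pow_succ']
    group
  intro m n
  rcases m with _ | m
  · simp [h.one]
    omega
  rcases n with _ | n
  · simp [h.one]
    omega
  have k1 := key u n
  have k2 := key u⁻¹ m
  simp only [inv_pow, h.inv] at k2
  have g1 := hgrow m
  have g2 := hgrow n
  have e1 : gprod ℓ u⁻¹ u 1 ≤ 4 * D + 2 := by
    rw [gprod_one_one, h.inv, inv_inv, ← pow_two]
    omega
  have e2 : gprod ℓ u⁻¹ (u ^ (n + 1)) 1 ≤ 5 * D + 2 := by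
    have := h.gprod_le_of_lt e1 (z := u ^ (n + 1)) (by omega)
    omega
  rw [h.gprod_comm] at e2
  have e3 := h.gprod_le_of_lt e2 (z := (u ^ (m + 1))⁻¹) (by omega)
  rw [h.gprod_comm, gprod_one_one, h.inv, inv_inv, ← pow_add] at e3
  omega

variable {e : ℤ} {u : G}

theorem IsAxial.nonneg (hu : IsAxial ℓ e u) : 0 ≤ e := by
  have := hu 0 0
  simpa [h.one] using this

theorem IsAxial.inv (hu : IsAxial ℓ e u) : IsAxial ℓ e u⁻¹ := by
  intro m n
  simpa [h.inv] using hu m n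

theorem IsAxial.mul_le (hu : IsAxial ℓ e u) (n : ℕ) : n * (ℓ u - e) ≤ ℓ (u ^ n) := by
  induction n with
  | zero => simp [h.one]
  | succ n ih =>
    have := hu n 1
    rw [pow_one] at this
    push_cast
    linarith

theorem length_pow_le (u : G) (n : ℕ) : ℓ (u ^ n) ≤ n * ℓ u := by
  induction n with
  | zero => simp [h.one]
  | succ n ih =>
    have := h.mul_le (u ^ n) u
    rw [pow_succ]
    push_cast
    linarith

theorem IsAxial.gprod_le (hu : IsAxial ℓ e u) {i j k : ℤ} (hij : i ≤ j) (hjk : j ≤ k) :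
    gprod ℓ (u ^ i) (u ^ k) (u ^ j) ≤ e := by
  obtain ⟨m, hm⟩ := Int.eq_ofNat_of_zero_le (sub_nonneg.2 hij)
  obtain ⟨n, hn⟩ := Int.eq_ofNat_of_zero_le (sub_nonneg.2 hjk)
  obtain rfl : i = j - m := by omega
  obtain rfl : k = j + n := by omega
  have e1 : u ^ (j - m : ℤ) = u ^ j * (u ^ m)⁻¹ := by rw [zpow_sub, zpow_natCast]
  have e2 : u ^ (j + n : ℤ) = u ^ j * u ^ n := by rw [zpow_add, zpow_natCast]
  have := hu m n
  rw [e1, e2, show gprod ℓ (u ^ j * (u ^ m)⁻¹) (u ^ j * u ^ n) (u ^ j) =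
    gprod ℓ (u ^ j * (u ^ m)⁻¹) (u ^ j * u ^ n) (u ^ j * 1) by rw [mul_one], gprod_mul_left,
    gprod_one_one, h.inv, inv_inv, ← pow_add]
  omega

/-- An element commuting with a power of `u` almost preserves the axis of `u`. -/
theorem IsAxial.exists_length_le_of_commute (hu : IsAxial ℓ e u) (heu : e < ℓ u) {x : G} {k : ℕ}
    (hk : 0 < k) (hx : Commute x (u ^ k)) :
    ∃ i j : ℕ, ℓ ((u ^ j)⁻¹ * (x * u ^ i)) ≤ 2 * e + 4 * D + 2 * ℓ u := by
  have hD := h.const_nonneg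
  have he := IsAxial.nonneg h hu
  have hgrow : ∀ n : ℕ, (n : ℤ) ≤ ℓ (u ^ n) := by
    intro n
    have := IsAxial.mul_le h hu n
    nlinarith
  have hx0 := h.nonneg x
  -- The point `p = u ^ j` is far from both `1` and `u ^ m`, whereas `x` moves each of these only by
  -- `ℓ x` (for `u ^ m` because it commutes with `x`). Hence `p` is also close to a geodesic from
  -- `x` to `x * u ^ m`.
  obtain ⟨j, hj⟩ := Int.eq_ofNat_of_zero_le (show 0 ≤ ℓ x + e + 3 * D + 1 by omega)
  obtain ⟨m, hm, hjm⟩ : ∃ m, Commute x (u ^ m) ∧ 2 * j ≤ m :=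
    ⟨k * (2 * j), by rw [pow_mul]; exact hx.pow_right _, by nlinarith⟩
  set p := u ^ j with hp
  have hpl : ℓ x + e + 3 * D + 1 ≤ ℓ p := by rw [hj]; exact hgrow j
  have hql : ℓ x + e + 3 * D + 1 ≤ ldist ℓ p (u ^ m) := by
    have := hgrow (m - j)
    have e1 : ldist ℓ p (u ^ m) = ℓ (u ^ (m - j)) := by
      rw [ldist, hp, ← pow_sub_mul_pow u (show j ≤ m by omega), ← pow_mul_comm,
        inv_mul_cancel_left]
    omega
  have a1 : gprod ℓ 1 (u ^ m) p ≤ e := by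
    have := IsAxial.gprod_le h hu (i := 0) (j := j) (k := m) (by omega) (by omega)
    simpa using this
  have a2 := h.le_gprod 1 x p
  rw [h.dist_one, one_dist, h.gprod_comm] at a2
  have a3 := h.le_gprod (u ^ m) (x * u ^ m) p
  rw [show ldist ℓ (u ^ m) (x * u ^ m) = ℓ x by
    rw [hm.eq, ldist, inv_mul_cancel_left], h.gprod_comm] at a3
  have a4 := h.gprod_le_of_lt a1 (z := x * u ^ m) (by omega)
  rw [h.gprod_comm] at a4
  have a5 := h.gprod_le_of_lt a4 (z := x) (by omega)
  rw [h.gprod_comm] at a5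
  -- Discrete continuity: at the first `n` for which the path `x * u ^ n` has passed `p`, the
  -- preceding point is near `p`. Here `n = 0` is impossible because `p` is far from `x`.
  have hex : ∃ n, gprod ℓ x (x * u ^ n) p ≤ e + 3 * D := ⟨m, by omega⟩
  classical
  have b1 := Nat.find_spec hex
  have b2 : ∀ n, n < Nat.find hex → ¬ gprod ℓ x (x * u ^ n) p ≤ e + 3 * D :=
    fun n hn => Nat.find_min hex hn
  have b3 : Nat.find hex ≤ m := Nat.find_min' hex (by omega)
  generalize Nat.find hex = n at b1 b2 b3
  rcases n with _ | i
  · exfalso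
    have : gprod ℓ x x p = 2 * ldist ℓ p x := by
      simp only [gprod, h.dist_self]
      ring
    have := h.dist_triangle p x 1
    rw [h.dist_one, h.dist_one] at this
    simp only [pow_zero, mul_one] at b1
    omega
  have b4 := b2 i (by omega)
  refine ⟨i, j, ?_⟩
  have c1 := h.gprod_le_add_dist x (x * u ^ i) (x * u ^ (i + 1)) p
  rw [dist_mul_left, show ldist ℓ (u ^ i) (u ^ (i + 1)) = ℓ u by simp [ldist, pow_succ]] at c1
  have c2 := h.min_gprod_le x (x * u ^ m) (x * u ^ i) p
  have c3 : gprod ℓ x (x * u ^ m) (x * u ^ i) ≤ e := by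
    have := IsAxial.gprod_le h hu (i := 0) (j := i) (k := m) (by omega) (by omega)
    rw [← gprod_mul_left x] at this
    simpa using this
  have c4 := h.min_gprod_le x (x * u ^ m) p (x * u ^ i)
  have c5 := h.gprod_add_gprod (x * u ^ i) x p
  have c6 := h.gprod_add_gprod (x * u ^ i) (x * u ^ m) p
  rw [h.gprod_comm (x * u ^ i) x p, h.gprod_comm p x (x * u ^ i)] at c5
  change ldist ℓ p (x * u ^ i) ≤ _
  omega

end Axis

/-! ### A criterion for free subgroups -/

section Free

variable (h : IsHyperbolicLength ℓ D)
include h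

/-- The element associated with a signed letter. -/
def letter {α : Type*} (s : α → G) (a : α × Bool) : G := bif a.2 then s a.1 else (s a.1)⁻¹

/-- The same local-to-global argument, for reduced words: the four-point condition for `x`, `x * y *
z`, `1`, `x * y`, with `x`, `y` the first two letters and `z` the rest. -/
theorem length_prod_add_one_le {α : Type*} (s : α → G)
    (hs : ∀ a b : α × Bool, (a.1 = b.1 → a.2 = b.2) →
      ℓ (letter s a) + D + 1 ≤ ℓ (letter s a * letter s b) ∧
        ℓ (letter s b) + D + 1 ≤ ℓ (letter s a * letter s b))
    (a : α × Bool) (l : List (α × Bool)) (hl : FreeGroup.IsReduced (a :: l)) :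
    ℓ (l.map (letter s)).prod + 1 ≤ ℓ ((a :: l).map (letter s)).prod := by
  have hD := h.const_nonneg
  induction l generalizing a with
  | nil =>
    have h1 := (hs a a fun _ => rfl).1
    have := h.mul_le (letter s a) (letter s a)
    simp [h.one]
    omega
  | cons b l ih =>
    rw [FreeGroup.isReduced_cons_cons] at hl
    have h1 := ih b hl.2
    obtain ⟨h2, h3⟩ := hs a b hl.1
    simp only [List.map_cons, List.prod_cons] at h1 ⊢
    generalize (l.map (letter s)).prod = z at *
    generalize letter s a = x at *
    generalize letter s b = y at *
    have h4 := h.four_point' x (x * (y * z)) 1 (x * y)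
    simp only [h.dist_one, one_dist] at h4
    simp only [ldist, inv_mul_cancel_left] at h4
    rw [show (x * (y * z))⁻¹ * (x * y) = z⁻¹ by group, h.inv] at h4
    omega

theorem injective_lift_of_length {α : Type*} [DecidableEq α] (s : α → G)
    (hs : ∀ a b : α × Bool, (a.1 = b.1 → a.2 = b.2) →
      ℓ (letter s a) + D + 1 ≤ ℓ (letter s a * letter s b) ∧
        ℓ (letter s b) + D + 1 ≤ ℓ (letter s a * letter s b)) :
    Function.Injective (FreeGroup.lift s) := by
  rw [injective_iff_map_eq_one]
  intro w hw
  have hred : FreeGroup.IsReduced w.toWord := FreeGroup.isReduced_toWord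
  have hprod : FreeGroup.lift s w = (w.toWord.map (letter s)).prod := by
    conv_lhs => rw [← FreeGroup.mk_toWord (x := w)]
    rw [FreeGroup.lift_mk]
    rfl
  rw [hprod] at hw
  rw [← FreeGroup.toWord_eq_nil_iff]
  generalize w.toWord = l at *
  rcases l with _ | ⟨a, l⟩
  · rfl
  · have := h.length_prod_add_one_le s hs a l hred
    rw [hw, h.one] at this
    have := h.nonneg (l.map (letter s)).prod
    omega

end Free

end IsHyperbolicLength

end KCSA

namespace KCSA

namespace IsHyperbolicLength

variable {G : Type*} [Group G] {ℓ : G → ℤ} {D : ℤ}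

/-! ### Free pairs -/

section Pair

variable (h : IsHyperbolicLength ℓ D)
include h

theorem gprod_le_add_base (x y p q : G) : gprod ℓ x y p ≤ gprod ℓ x y q + 2 * ldist ℓ p q := by
  have := h.dist_triangle p q x
  have := h.dist_triangle p q y
  simp only [gprod]
  omega

/-- Ping-pong for two elements. -/
theorem injective_lift_pair {x y : G} (hx : gprod ℓ x x⁻¹ 1 + D + 1 ≤ ℓ x)
    (hy : gprod ℓ y y⁻¹ 1 + D + 1 ≤ ℓ y)
    (hxy : ∀ x' y', (x' = x ∨ x' = x⁻¹) → (y' = y ∨ y' = y⁻¹) →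
      gprod ℓ x' y' 1 + D + 1 ≤ ℓ x ∧ gprod ℓ x' y' 1 + D + 1 ≤ ℓ y) :
    Function.Injective (FreeGroup.lift ![x, y]) := by
  have h0 : ∀ b : Bool, letter ![x, y] (0, b) = x ∧ b = true ∨
      letter ![x, y] (0, b) = x⁻¹ ∧ b = false := by
    intro b
    cases b <;> simp [letter]
  have h1 : ∀ b : Bool, letter ![x, y] (1, b) = y ∧ b = true ∨
      letter ![x, y] (1, b) = y⁻¹ ∧ b = false := by
    intro b
    cases b <;> simp [letter]
  have key : ∀ a b : Fin 2 × Bool, a ≠ b →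
      gprod ℓ (letter ![x, y] a) (letter ![x, y] b) 1 + D + 1 ≤ ℓ (letter ![x, y] a) := by
    rintro ⟨i, a⟩ ⟨j, b⟩ hab
    have hx' := h.gprod_comm x x⁻¹ 1
    have hy' := h.gprod_comm y y⁻¹ 1
    fin_cases i <;> fin_cases j
    · rcases h0 a with ⟨ea, rfl⟩ | ⟨ea, rfl⟩ <;> rcases h0 b with ⟨eb, rfl⟩ | ⟨eb, rfl⟩ <;>
        simp_all [h.inv]
    · have := hxy (letter ![x, y] (0, a)) (letter ![x, y] (1, b))
        ((h0 a).imp And.left And.left) ((h1 b).imp And.left And.left)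
      rcases h0 a with ⟨ea, rfl⟩ | ⟨ea, rfl⟩
      · simpa [ea] using this.1
      · simpa [ea, h.inv] using this.1
    · change gprod ℓ (letter ![x, y] (1, a)) (letter ![x, y] (0, b)) 1 + D + 1 ≤
        ℓ (letter ![x, y] (1, a))
      have := hxy (letter ![x, y] (0, b)) (letter ![x, y] (1, a))
        ((h0 b).imp And.left And.left) ((h1 a).imp And.left And.left)
      have hc := h.gprod_comm (letter ![x, y] (0, b)) (letter ![x, y] (1, a)) 1
      rcases h1 a with ⟨ea, rfl⟩ | ⟨ea, rfl⟩
      · rw [hc, ea] at this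
        rw [ea]
        exact this.2
      · rw [hc, ea] at this
        rw [ea, h.inv]
        exact this.2
    · rcases h1 a with ⟨ea, rfl⟩ | ⟨ea, rfl⟩ <;> rcases h1 b with ⟨eb, rfl⟩ | ⟨eb, rfl⟩ <;>
        simp_all [h.inv]
  refine h.injective_lift_of_length _ fun a b hab => ?_
  have hinv : letter ![x, y] (a.1, !a.2) = (letter ![x, y] a)⁻¹ := by
    obtain ⟨i, a⟩ := a
    cases a <;> simp [letter]
  have hne : (a.1, !a.2) ≠ b := by
    rintro rfl
    simpa using hab rfl
  have k1 := key _ _ hne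
  have k2 := key _ _ hne.symm
  rw [h.gprod_comm] at k2
  rw [hinv, gprod_one_one, inv_inv, h.inv] at k1 k2
  omega

/-- Two points close to a geodesic from `1` to `P` are determined, up to bounded error, by their
distance to `1`. -/
theorem dist_le_of_gprod_le {P y z : G} {c : ℤ} (hy : gprod ℓ 1 P y ≤ c)
    (hz : gprod ℓ 1 P z ≤ c) :
    ldist ℓ y z ≤ ℓ y - ℓ z + c + D ∨ ldist ℓ y z ≤ ℓ z - ℓ y + c + D := by
  have := h.four_point' y z 1 P
  simp only [gprod, h.dist_one, one_dist] at *
  omega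

end Pair

/-- The algebra behind the pigeonhole in `exists_commute_of_gprod`, where `b`, `c`, `d` are powers
of one element. -/
theorem commute_of_conj_eq {b c d v : G} (hb : Commute b d)
    (hf : (c * (v * b))⁻¹ * (v * (b * c)) = (d * c * (v * b))⁻¹ * (v * (b * (d * c)))) :
    Commute d v := by
  have h1 := congrArg (fun z => d * c * (v * b) * z) hf
  have h2 : d * c * (v * b) * ((c * (v * b))⁻¹ * (v * (b * c))) = d * v * (b * c) := by group
  simp only [h2, mul_inv_cancel_left] at h1
  rw [← mul_assoc b, hb.eq] at h1
  exact mul_right_cancel (h1.trans (by simp only [mul_assoc]))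

/-! ### Long overlaps of quasi-axes force commutation -/

section Overlap

variable (h : IsHyperbolicLength ℓ D) {e l : ℤ}
include h

/-- Translating a point of the first axis along the second one, while the axes are close. -/
theorem length_conj_mul {a w x : G} (ha : IsAxial ℓ e a) (hw : IsAxial ℓ e w) (hal : ℓ a = l)
    (hwl : ℓ w = l) (hl : 20 * e + 20 * D + 20 ≤ l) (hx : ℓ x ≤ 3 * l) {M N n : ℕ}
    (hN : 4 * M + 200 ≤ N) (hn : 10 ≤ n) (hnM : n ≤ 10 + M)
    (hT : 2 * (M + 30) * l < gprod ℓ (a ^ N) (x * w ^ N) 1) :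
    gprod ℓ 1 (a ^ N) (x * w * x⁻¹ * a ^ n) ≤ e + 5 * D ∧
      ℓ (x * w * x⁻¹ * a ^ n) ≤ ℓ (a ^ n) + l + 2 * e + 4 * D ∧
      ℓ (a ^ n) + l ≤ ℓ (x * w * x⁻¹ * a ^ n) + 2 * e + 4 * D ∧
      8 * l ≤ ℓ (a ^ n) ∧ ℓ (a ^ n) ≤ (M + 10) * l := by
  have hD := h.const_nonneg
  have he := IsAxial.nonneg h ha
  have hM : 0 ≤ (M : ℤ) * l := by nlinarith
  have n1 : 8 * l ≤ ℓ (a ^ n) := by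
    have := IsAxial.mul_le h ha n
    nlinarith
  have n2 : ℓ (a ^ n) ≤ (M + 10) * l := by
    have := h.length_pow_le a n
    rw [hal] at this
    nlinarith
  have hT' : 2 * ((M : ℤ) * l) + 60 * l < gprod ℓ (a ^ N) (x * w ^ N) 1 := by linarith
  have n2' : ℓ (a ^ n) ≤ (M : ℤ) * l + 10 * l := by linarith
  have n3 : 2 * ((M : ℤ) * l) + 100 * l ≤ ℓ (w ^ (N - 1)) := by
    have := IsAxial.mul_le h hw (N - 1)
    rw [hwl] at this
    have e1 : 2 * (l - e) ≥ l + 18 * e := by linarith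
    have e2 : ((N - 1 : ℕ) : ℤ) ≥ 4 * M + 199 := by omega
    have e3 : 0 ≤ l - e := by omega
    have e4 : (4 * M + 199) * (l - e) ≤ ((N - 1 : ℕ) : ℤ) * (l - e) :=
      mul_le_mul_of_nonneg_right e2 e3
    have e5 : 0 ≤ (M : ℤ) * e := by positivity
    have e6 : (M : ℤ) * (20 * e) ≤ M * l := mul_le_mul_of_nonneg_left (by omega) (by positivity)
    nlinarith
  generalize (M : ℤ) * l = Z at *
  suffices hmain : gprod ℓ 1 (a ^ N) (x * w * x⁻¹ * a ^ n) ≤ e + 5 * D ∧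
      ℓ (x * w * x⁻¹ * a ^ n) ≤ ℓ (a ^ n) + l + 2 * e + 4 * D ∧
      ℓ (a ^ n) + l ≤ ℓ (x * w * x⁻¹ * a ^ n) + 2 * e + 4 * D from
    ⟨hmain.1, hmain.2.1, hmain.2.2, n1, n2⟩
  set s := a ^ n with hs
  set P := a ^ N with hP
  set Q := x * w ^ N with hQ
  set Q' := x * w ^ (N - 1) with hQ'
  set v := x * w * x⁻¹ with hv
  have hwN : w ^ N = w ^ (N - 1) * w := by rw [← pow_succ]; congr 1; omega
  have hvx : v * x = x * w := by simp [hv]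
  have hvQ' : v * Q' = Q := by
    rw [hQ, hQ', hv, hwN, ← pow_succ, pow_succ']
    group
  have hvQ : v * Q = x * w ^ N * w := by
    rw [hQ, hv, mul_assoc x (w ^ N) w, ← pow_succ, pow_succ']
    group
  -- the point `s` lies between `1` and `Q`
  have b1 : gprod ℓ 1 P s ≤ e := by
    have := IsAxial.gprod_le h ha (i := 0) (j := n) (k := N) (by omega) (by omega)
    simpa using this
  have b1' := h.gprod_add_gprod s P 1
  have b2 := h.min_gprod_le s Q P 1
  have b2' := h.gprod_add_gprod s Q 1
  rw [one_dist] at b1' b2'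
  have b2 : gprod ℓ 1 Q s ≤ e + D := by omega
  have ds : ldist ℓ x s ≤ ℓ x + ℓ s := by
    have := h.dist_triangle x 1 s
    rwa [h.dist_one, one_dist] at this
  have ds' : ℓ s ≤ ℓ x + ldist ℓ x s := by
    have := h.dist_triangle 1 x s
    rwa [one_dist, one_dist] at this
  have b3 : gprod ℓ Q x s ≤ e + 2 * D := by
    have := h.le_gprod 1 x s
    rw [h.dist_one, one_dist, h.gprod_comm] at this
    rw [h.gprod_comm] at b2
    have := h.gprod_le_of_lt b2 (z := x) (by omega)
    omega
  -- the point `v * s` lies between `1` and `Q`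
  have dQ' : ldist ℓ Q' x = ℓ (w ^ (N - 1)) := by
    rw [h.dist_comm, hQ', ldist, inv_mul_cancel_left]
  have dQQ' : ldist ℓ Q' Q = l := by
    rw [hQ, hQ', hwN, ldist, ← hwl]
    congr 1
    group
  have dvs : ldist ℓ (v * s) Q = ldist ℓ s Q' := by rw [← hvQ', dist_mul_left]
  have dsQ' : ℓ (w ^ (N - 1)) ≤ ldist ℓ x s + ldist ℓ s Q' := by
    have := h.dist_triangle x s Q'
    rwa [h.dist_comm x Q', dQ'] at this
  have b4 : gprod ℓ (v * Q) (x * w) (v * s) ≤ e + 2 * D := by rwa [← hvx, gprod_mul_left]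
  have b5 : gprod ℓ (v * Q) 1 (v * s) ≤ e + 3 * D := by
    have h1 := h.le_gprod (x * w) 1 (v * s)
    have h2 : ldist ℓ (v * s) (x * w) = ldist ℓ s x := by rw [← hvx, dist_mul_left]
    have h3 := h.mul_le x w
    have h4 := h.dist_comm x s
    rw [h.dist_one, h.gprod_comm, h2] at h1
    have := h.gprod_le_of_lt b4 (z := 1) (by omega)
    omega
  have b6 : gprod ℓ 1 Q (v * s) ≤ e + 4 * D := by
    have h1 := h.le_gprod (v * Q) Q (v * s)
    have h2 : ldist ℓ (v * Q) Q = l := by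
      rw [hvQ, h.dist_comm, hQ, ldist, ← hwl]
      congr 1
      group
    have h3 := h.dist_triangle (v * s) (v * Q) Q
    have h4 := h.dist_triangle (v * s) Q (v * Q)
    have h5 := h.dist_comm Q (v * Q)
    rw [h.gprod_comm, h2] at h1
    rw [h.gprod_comm] at b5
    have := h.gprod_le_of_lt b5 (z := Q) (by omega)
    omega
  -- comparison of the distances to `Q`
  have b7 : gprod ℓ Q s Q' ≤ e + D := by
    have h1 : gprod ℓ Q x Q' ≤ e := by
      have := IsAxial.gprod_le h hw (i := 0) (j := (N - 1 : ℕ)) (k := N) (by omega) (by omega)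
      rw [← gprod_mul_left x, h.gprod_comm] at this
      simpa only [zpow_natCast, zpow_zero, mul_one] using this
    have h2 := h.le_gprod x s Q'
    rw [h.gprod_comm] at h2
    exact h.gprod_le_of_lt h1 (by omega)
  have b8 := h.gprod_nonneg 1 Q s
  have b9 := h.gprod_nonneg 1 Q (v * s)
  have b10 := h.gprod_nonneg Q s Q'
  have hc1 := h.dist_comm s Q
  have hc2 := h.dist_comm s Q'
  have b11 : ℓ (v * s) ≤ ℓ s + l + 2 * e + 4 * D ∧ ℓ s + l ≤ ℓ (v * s) + 2 * e + 4 * D := by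
    simp only [gprod, h.dist_one, one_dist] at b2 b6 b7 b8 b9 b10
    omega
  refine ⟨?_, b11⟩
  have c1 := h.min_gprod_le (v * s) P Q 1
  have c2 := h.gprod_add_gprod (v * s) Q 1
  have c3 := h.gprod_add_gprod (v * s) P 1
  have c4 := h.gprod_comm P Q 1
  rw [one_dist] at c2 c3
  omega

/-- Translating a point close to the axis of `a`. -/
theorem length_pow_mul {a y : G} (ha : IsAxial ℓ e a) (hal : ℓ a = l)
    (hl : 20 * e + 20 * D + 20 ≤ l) {M N i : ℕ} (hN : 4 * M + 200 ≤ N) (hi : i ≤ M)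
    (hy : gprod ℓ 1 (a ^ N) y ≤ e + 5 * D) (hyl : l ≤ ℓ y) (hyM : ℓ y ≤ (M + 20) * l) :
    gprod ℓ 1 (a ^ N) (a ^ i * y) ≤ e + 7 * D ∧ ℓ (a ^ i * y) ≤ ℓ (a ^ i) + ℓ y ∧
      ℓ (a ^ i) + ℓ y ≤ ℓ (a ^ i * y) + e + D := by
  have hD := h.const_nonneg
  have he := IsAxial.nonneg h ha
  have n2 : ℓ (a ^ i) ≤ M * l := by
    have := h.length_pow_le a i
    rw [hal] at this
    nlinarith
  have n3 : 2 * ((M : ℤ) * l) + 100 * l ≤ ℓ (a ^ N) := by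
    have := IsAxial.mul_le h ha N
    rw [hal] at this
    have e2 : (N : ℤ) ≥ 4 * M + 200 := by omega
    have e3 : 0 ≤ l - e := by omega
    have e4 : (4 * M + 200) * (l - e) ≤ (N : ℤ) * (l - e) :=
      mul_le_mul_of_nonneg_right e2 e3
    have e5 : 0 ≤ (M : ℤ) * e := by positivity
    have e6 : (M : ℤ) * (20 * e) ≤ M * l := mul_le_mul_of_nonneg_left (by omega) (by positivity)
    nlinarith
  have n4 : ℓ y ≤ (M : ℤ) * l + 20 * l := by linarith
  generalize (M : ℤ) * l = Z at *
  set P := a ^ N with hP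
  have c1 : gprod ℓ (a ^ i)⁻¹ P 1 ≤ e := by
    have := IsAxial.gprod_le h ha (i := -i) (j := 0) (k := N) (by omega) (by omega)
    simpa using this
  have c2 := h.gprod_add_gprod y P 1
  rw [one_dist, h.gprod_comm y P] at c2
  have c3 := h.gprod_le_of_lt c1 (z := y) (by rw [h.gprod_comm]; omega)
  have c4 := h.gprod_add_gprod y (a ^ i)⁻¹ 1
  rw [one_dist, h.gprod_comm y] at c4
  rw [h.gprod_comm] at hy
  have c5 := h.gprod_le_of_lt hy (z := (a ^ i)⁻¹) (by rw [h.gprod_comm]; omega)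
  have hiN : i ≤ N := by omega
  have c6 := h.le_gprod P (a ^ (N - i)) y
  have c7 : ldist ℓ P (a ^ (N - i)) = ℓ (a ^ i) := by
    rw [h.dist_comm, ldist, hP, ← pow_sub_mul_pow a hiN, inv_mul_cancel_left]
  have c8 := h.dist_triangle 1 y P
  rw [one_dist, one_dist] at c8
  rw [h.gprod_comm] at c5
  have c9 := h.gprod_le_of_lt c5 (z := a ^ (N - i)) (by rw [h.gprod_comm]; omega)
  rw [← gprod_mul_left (a ^ i), mul_inv_cancel, ← pow_add, Nat.add_sub_cancel' hiN, ← hP] at c9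
  rw [gprod_one_one, inv_inv, h.inv] at c3
  exact ⟨by omega, h.mul_le _ _, by omega⟩

/-- If the axes of `a` and `x * w * x⁻¹` stay close for a long time, then a power of `a` commutes
with `x * w * x⁻¹`. -/
theorem exists_commute_of_gprod {a w x : G} (ha : IsAxial ℓ e a) (hw : IsAxial ℓ e w)
    (hal : ℓ a = l) (hwl : ℓ w = l) (hl : 20 * e + 20 * D + 20 ≤ l) (hx : ℓ x ≤ 3 * l) {M N : ℕ}
    (hM : (h.finite_ball (7 * e + 17 * D)).toFinset.card ≤ M) (hN : 4 * M + 200 ≤ N)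
    (hT : 2 * (M + 30) * l < gprod ℓ (a ^ N) (x * w ^ N) 1) :
    ∃ k, 0 < k ∧ Commute (a ^ k) (x * w * x⁻¹) := by
  have hD := h.const_nonneg
  have he := IsAxial.nonneg h ha
  set v := x * w * x⁻¹ with hv
  -- Both `a ^ i * v * a ^ 10` and `v * a ^ (10 + i)` lie near a geodesic from `1` to `a ^ N`, at
  -- nearly the same distance from `1`, so `f i` stays in a fixed ball. Two of the `M + 1` values
  -- agree, which yields the commuting power. The shift by `10` keeps the points beyond the part
  -- disturbed by `x`.
  let f : ℕ → G := fun i => (a ^ i * (v * a ^ 10))⁻¹ * (v * a ^ (10 + i))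
  have hf : ∀ i ∈ Finset.range (M + 1), f i ∈ (h.finite_ball (7 * e + 17 * D)).toFinset := by
    intro i hi
    have hi : i ≤ M := by simpa [Nat.lt_succ_iff] using hi
    obtain ⟨p1, p2, p3, p4, p5⟩ := h.length_conj_mul ha hw hal hwl hl hx hN (n := 10) le_rfl
      (by omega) hT
    obtain ⟨q1, q2, q3, q4, q5⟩ := h.length_conj_mul ha hw hal hwl hl hx hN (n := 10 + i)
      (by omega) (by omega) hT
    obtain ⟨r1, r2, r3⟩ := h.length_pow_mul ha hal hl hN hi p1 (by omega) (by
      have : 2 * e + 4 * D ≤ l := by omega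
      linarith)
    have s1 := ha 10 i
    have s2 := h.mul_le (a ^ 10) (a ^ i)
    rw [← pow_add] at s2
    have t := h.dist_le_of_gprod_le r1 (q1.trans (by omega : _ ≤ e + 7 * D))
    rw [ldist] at t
    have goal : ℓ (f i) ≤ 7 * e + 17 * D := by
      simp only [f, hv]
      omega
    simpa using goal
  obtain ⟨i, hi, j, hj, hij, hfij⟩ :=
    Finset.exists_ne_map_eq_of_card_lt_of_maps_to (by simpa using hM.trans_lt (Nat.lt_succ_self M)) hf
  have key : ∀ i j : ℕ, i < j → f i = f j → ∃ k, 0 < k ∧ Commute (a ^ k) v := by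
    intro i j hij hf
    obtain ⟨k, rfl⟩ := Nat.exists_eq_add_of_lt hij
    refine ⟨k + 1, by omega, ?_⟩
    simp only [f, show i + k + 1 = (k + 1) + i by ring, pow_add a (k + 1) i, pow_add a 10] at hf
    exact commute_of_conj_eq ((Commute.refl a).pow_pow 10 (k + 1)) hf
  rcases lt_or_gt_of_ne hij with hlt | hlt
  · exact key i j hlt hfij
  · exact key j i hlt hfij.symm

end Overlap

end IsHyperbolicLength

end KCSA

namespace KCSA

theorem injective_lift_conj_iff {G : Type*} [Group G] (a b y : G) :
    Function.Injective (FreeGroup.lift ![y * a * y⁻¹, y * b * y⁻¹]) ↔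
      Function.Injective (FreeGroup.lift ![a, b]) := by
  have e : FreeGroup.lift ![y * a * y⁻¹, y * b * y⁻¹] =
      ((MulAut.conj y).toMonoidHom).comp (FreeGroup.lift ![a, b]) := by
    ext k
    fin_cases k <;> simp
  rw [e, MonoidHom.coe_comp]
  exact (MulAut.conj y).injective.of_comp_iff _

namespace IsHyperbolicLength

variable {G : Type*} [Group G] {ℓ : G → ℤ} {D : ℤ}

/-! ### Uniform exponents for free subgroups -/

section Free

variable (h : IsHyperbolicLength ℓ D) {e l : ℤ}
include h

theorem IsAxial.gprod_pow_inv (e : ℤ) {u : G} (hu : IsAxial ℓ e u) (n : ℕ) :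
    gprod ℓ (u ^ n) (u ^ n)⁻¹ 1 ≤ e := by
  have := IsAxial.gprod_le h hu (i := -n) (j := 0) (k := n) (by omega) (by omega)
  rw [h.gprod_comm] at this
  simpa using this

/-- By `exists_commute_of_gprod` the two axes overlap at most in a length controlled by `M`, in each
of the four directions. The choice of `N` makes the powers longer than this overlap, up to the
displacement by the short `x`, so ping-pong applies. -/
theorem injective_lift_of_short {u x : G} (hu : IsAxial ℓ e u) (hul : ℓ u = l)
    (hl : 20 * e + 20 * D + 20 ≤ l) (hx : ℓ x ≤ 3 * l) {M N : ℕ}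
    (hM : (h.finite_ball (7 * e + 17 * D)).toFinset.card ≤ M) (hN : 4 * M + 200 ≤ N)
    (hcomm : ∀ k, 0 < k → ¬ Commute (u ^ k) (x * u * x⁻¹)) :
    Function.Injective (FreeGroup.lift ![u ^ N, x * u ^ N * x⁻¹]) := by
  have hD := h.const_nonneg
  have he := IsAxial.nonneg h hu
  have n1 : 2 * ((M : ℤ) * l) + 100 * l ≤ ℓ (u ^ N) := by
    have := IsAxial.mul_le h hu N
    rw [hul] at this
    have e2 : (N : ℤ) ≥ 4 * M + 200 := by omega
    have e3 : 0 ≤ l - e := by omega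
    have e4 : (4 * M + 200) * (l - e) ≤ (N : ℤ) * (l - e) :=
      mul_le_mul_of_nonneg_right e2 e3
    have e5 : 0 ≤ (M : ℤ) * e := by positivity
    have e6 : (M : ℤ) * (20 * e) ≤ M * l := mul_le_mul_of_nonneg_left (by omega) (by positivity)
    nlinarith
  have hM0 : 0 ≤ (M : ℤ) * l := mul_nonneg (by positivity) (by omega)
  have key : ∀ a w : G, (a = u ∨ a = u⁻¹) → (w = u ∨ w = u⁻¹) →
      gprod ℓ (a ^ N) (x * w ^ N) 1 ≤ 2 * (M + 30) * l := by
    intro a w ha hw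
    by_contra! hT
    have hax : ∀ b, (b = u ∨ b = u⁻¹) → IsAxial ℓ e b ∧ ℓ b = l := by
      rintro b (rfl | rfl)
      · exact ⟨hu, hul⟩
      · exact ⟨IsAxial.inv h hu, by rw [h.inv, hul]⟩
    obtain ⟨k, hk, hc⟩ := h.exists_commute_of_gprod (hax a ha).1 (hax w hw).1 (hax a ha).2
      (hax w hw).2 hl hx hM hN hT
    refine hcomm k hk ?_
    have e1 : x * u⁻¹ * x⁻¹ = (x * u * x⁻¹)⁻¹ := by group
    rcases ha with rfl | rfl <;> rcases hw with rfl | rfl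
    · exact hc
    · rwa [e1, Commute.inv_right_iff] at hc
    · rwa [inv_pow, Commute.inv_left_iff] at hc
    · rwa [e1, inv_pow, Commute.inv_left_iff, Commute.inv_right_iff] at hc
  have g1 := IsAxial.gprod_pow_inv h e hu N
  have hconj : ∀ z, ldist ℓ (x * z) (x * z * x⁻¹) = ℓ x := fun z => by
    rw [ldist, inv_mul_cancel_left, h.inv]
  have e1 : (x * u ^ N * x⁻¹)⁻¹ = x * u⁻¹ ^ N * x⁻¹ := by
    rw [inv_pow]
    group
  have n2 : ℓ (u ^ N) ≤ ℓ (x * u ^ N * x⁻¹) + 2 * ℓ x := by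
    have h1 := h.mul_le (x⁻¹ * (x * u ^ N * x⁻¹)) x
    have h2 := h.mul_le x⁻¹ (x * u ^ N * x⁻¹)
    rw [show x⁻¹ * (x * u ^ N * x⁻¹) * x = u ^ N by group] at h1
    rw [h.inv] at h2
    omega
  refine h.injective_lift_pair (by omega) ?_ ?_
  · rw [e1]
    have h1 := h.gprod_le_add_dist (x * u ^ N * x⁻¹) (x * u⁻¹ ^ N * x⁻¹) (x * u⁻¹ ^ N) 1
    have h2 := h.gprod_le_add_dist (x * u⁻¹ ^ N) (x * u ^ N * x⁻¹) (x * u ^ N) 1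
    have h3 := h.gprod_le_add_base (x * u⁻¹ ^ N) (x * u ^ N) 1 x
    have h4 : gprod ℓ (x * u⁻¹ ^ N) (x * u ^ N) x = gprod ℓ (u⁻¹ ^ N) (u ^ N) 1 := by
      rw [← gprod_mul_left x _ _ 1, mul_one]
    rw [h.dist_comm, hconj] at h1 h2
    rw [h.gprod_comm] at h2
    rw [one_dist, h4, inv_pow, h.gprod_comm _ (u ^ N)] at h3
    rw [inv_pow] at *
    omega
  · intro x' y' hx' hy'
    obtain ⟨a, ha, rfl⟩ : ∃ a, (a = u ∨ a = u⁻¹) ∧ x' = a ^ N := by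
      rcases hx' with rfl | rfl
      · exact ⟨u, Or.inl rfl, rfl⟩
      · exact ⟨u⁻¹, Or.inr rfl, by rw [inv_pow]⟩
    obtain ⟨w, hw, rfl⟩ : ∃ w, (w = u ∨ w = u⁻¹) ∧ y' = x * w ^ N * x⁻¹ := by
      rcases hy' with rfl | rfl
      · exact ⟨u, Or.inl rfl, rfl⟩
      · exact ⟨u⁻¹, Or.inr rfl, e1⟩
    have h1 := h.gprod_le_add_dist (a ^ N) (x * w ^ N * x⁻¹) (x * w ^ N) 1
    rw [h.dist_comm, hconj] at h1
    have h2 := key a w ha hw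
    have h3 : gprod ℓ (a ^ N) (x * w ^ N) 1 ≤ 2 * (M * l) + 60 * l := by linarith
    constructor <;> omega

/-- The path made of `x`, `w ^ n`, `x⁻¹` backtracks little at its two corners, and its middle piece
is long. -/
theorem length_conj_pow_of_long {w x : G} {n : ℕ}
    (hl : 20 * e + 20 * D + 20 ≤ l) (he : 0 ≤ e)
    (hnear : ∀ b : G, (b = w ^ n ∨ b = (w ^ n)⁻¹) → gprod ℓ b x⁻¹ 1 ≤ l + D)
    (hn : 3 * l ≤ ℓ (w ^ n)) :
    2 * ℓ x + ℓ (w ^ n) - 2 * l - 3 * D ≤ ℓ (x * w ^ n * x⁻¹) := by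
  have hD := h.const_nonneg
  have h1 := hnear _ (Or.inl rfl)
  have h2 := hnear _ (Or.inr rfl)
  have h3 : gprod ℓ x (x * w ^ n * x⁻¹) (x * w ^ n) ≤ l + D := by
    rwa [← gprod_mul_left (x * w ^ n), mul_one, mul_inv_cancel_right] at h2
  have h4 : ℓ (x * w ^ n) = ℓ x + ℓ (w ^ n) - gprod ℓ (w ^ n) x⁻¹ 1 := by
    rw [h.gprod_comm, gprod_one_one, inv_inv, h.inv]
    ring
  have h5 : gprod ℓ 1 x (x * w ^ n) = ℓ (x * w ^ n) + ℓ (w ^ n) - ℓ x := by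
    simp only [gprod, h.dist_one, one_dist]
    rw [h.dist_comm, ldist, inv_mul_cancel_left]
  rw [h.gprod_comm] at h3
  have h6 := h.gprod_le_of_lt h3 (z := 1) (by omega)
  simp only [gprod, h.dist_one] at h6
  have h7 : ldist ℓ (x * w ^ n) (x * w ^ n * x⁻¹) = ℓ x := by
    rw [ldist, inv_mul_cancel_left, h.inv]
  omega

/-- Since `x` is shortest in its double coset of `⟨u⟩`, both `x` and `x⁻¹` leave the axis of `u`
early. Hence `x * u ^ N * x⁻¹` and its inverse follow `x` for most of its length, away from the
powers of `u`. -/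
theorem injective_lift_of_long {u x : G} (hu : IsAxial ℓ e u) (hul : ℓ u = l)
    (hl : 20 * e + 20 * D + 20 ≤ l) (hx : 3 * l ≤ ℓ x) {N : ℕ} (hN : 200 ≤ N)
    (hmin : ∀ i j : ℤ, ℓ x ≤ ℓ (u ^ i * x * u ^ j)) :
    Function.Injective (FreeGroup.lift ![u ^ N, x * u ^ N * x⁻¹]) := by
  have hD := h.const_nonneg
  have he := IsAxial.nonneg h hu
  have hgrow : ∀ n, 200 ≤ n → 100 * l ≤ ℓ (u ^ n) := by
    intro n hn
    have := IsAxial.mul_le h hu n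
    rw [hul] at this
    have e2 : (200 : ℤ) ≤ n := by omega
    nlinarith
  have near : ∀ (a y : G), (a = u ∨ a = u⁻¹) → (y = x ∨ y = x⁻¹) → ∀ n, 200 ≤ n →
      gprod ℓ (a ^ n) y 1 ≤ l + D := by
    intro a y ha hy n hn
    have hax : IsAxial ℓ e a ∧ ℓ a = l := by
      rcases ha with rfl | rfl
      · exact ⟨hu, hul⟩
      · exact ⟨IsAxial.inv h hu, by rw [h.inv, hul]⟩
    have hya : ℓ y ≤ ℓ (a⁻¹ * y) := by
      have e2 : (x * u ^ (1 : ℤ))⁻¹ = u⁻¹ * x⁻¹ := by simp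
      have e3 : (x * u ^ (-1 : ℤ))⁻¹ = u * x⁻¹ := by simp
      have m1 := hmin 1 0
      have m2 := hmin (-1) 0
      have m3 := hmin 0 1
      have m4 := hmin 0 (-1)
      simp only [zpow_zero, one_mul, mul_one] at m1 m2 m3 m4
      rw [← h.inv (x * u ^ (1 : ℤ)), e2] at m3
      rw [← h.inv (x * u ^ (-1 : ℤ)), e3] at m4
      simp only [zpow_one, zpow_neg] at m1 m2
      rcases ha with rfl | rfl <;> rcases hy with rfl | rfl <;>
        simpa [h.inv]
    have h1 : gprod ℓ a y 1 ≤ l := by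
      rw [gprod_one_one]
      omega
    have h2 : gprod ℓ 1 (a ^ n) a ≤ e := by
      have := IsAxial.gprod_le h hax.1 (i := 0) (j := 1) (k := n) (by omega) (by omega)
      simpa using this
    have h3 := h.gprod_add_gprod a (a ^ n) 1
    rw [one_dist] at h3
    rw [h.gprod_comm] at h1
    rw [h.gprod_comm]
    exact h.gprod_le_of_lt h1 (by rw [h.gprod_comm]; omega)
  have near' : ∀ (y : G), (y = x ∨ y = x⁻¹) → ∀ n, 200 ≤ n →
      ∀ b : G, (b = u ^ n ∨ b = (u ^ n)⁻¹) → gprod ℓ b y 1 ≤ l + D := by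
    rintro y hy n hn b (rfl | rfl)
    · exact near u y (Or.inl rfl) hy n hn
    · rw [← inv_pow]
      exact near u⁻¹ y (Or.inr rfl) hy n hn
  have n1 := hgrow N hN
  have g1 := IsAxial.gprod_pow_inv h e hu N
  have v1 := h.length_conj_pow_of_long hl he (near' x⁻¹ (Or.inr rfl) N hN) (by omega)
  have v2 := h.length_conj_pow_of_long hl he (near' x⁻¹ (Or.inr rfl) (N + N) (by omega))
    (by have := hgrow (N + N) (by omega); omega)
  have v3 := hu N N
  have v4 := h.mul_le (x * u ^ N) x⁻¹
  have v5 := h.mul_le x (u ^ N)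
  rw [h.inv] at v4
  refine h.injective_lift_pair (by omega) ?_ ?_
  · rw [h.gprod_comm, gprod_one_one, inv_inv, h.inv,
      show x * u ^ N * x⁻¹ * (x * u ^ N * x⁻¹) = x * u ^ (N + N) * x⁻¹ by rw [pow_add]; group]
    omega
  · intro x' y' hx' hy'
    have h1 : gprod ℓ x y' 1 ≥ 2 * ℓ x - 2 * l - 3 * D := by
      have key : ∀ z : G, ℓ z = ℓ (u ^ N) → y' = x * z * x⁻¹ → ℓ y' = ℓ (x * u ^ N * x⁻¹) →
          gprod ℓ x y' 1 ≥ 2 * ℓ x - 2 * l - 3 * D := by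
        intro z hz hy hl'
        have := h.mul_le z x⁻¹
        rw [gprod_one_one, hl', hy, show x⁻¹ * (x * z * x⁻¹) = z * x⁻¹ by group]
        rw [h.inv] at this
        omega
      rcases hy' with rfl | rfl
      · exact key _ rfl rfl rfl
      · exact key (u ^ N)⁻¹ (h.inv _) (by group) (h.inv _)
    have h2 := near' x (Or.inl rfl) N hN x' hx'
    have h3 := h.gprod_le_of_lt h2 (z := y') (by rw [h.gprod_comm]; omega)
    constructor <;> omega

/-- Large powers of an element with a long axis and of a conjugate freely generate a free group,
with a uniform bound. -/
theorem injective_lift_of_axial {u x : G} (hu : IsAxial ℓ e u) (hl : 20 * e + 20 * D + 20 ≤ ℓ u)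
    {N : ℕ} (hN : 4 * (h.finite_ball (7 * e + 17 * D)).toFinset.card + 200 ≤ N)
    (hcomm : ∀ k, 0 < k → ¬ Commute (u ^ k) (x * u * x⁻¹)) :
    Function.Injective (FreeGroup.lift ![u ^ N, x * u ^ N * x⁻¹]) := by
  -- A shortest representative `y` of the double coset of `x` with respect to `⟨u⟩`. The pair `u ^
  -- N`, `y * u ^ N * y⁻¹` is the conjugate by `u ^ i` of the original pair, so freeness is
  -- unaffected.
  obtain ⟨i, j, hmin⟩ : ∃ i j : ℤ, ∀ i' j' : ℤ,
      ℓ (u ^ i * x * u ^ j) ≤ ℓ (u ^ i' * x * u ^ j') := by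
    let f : ℤ × ℤ → ℕ := fun p => (ℓ (u ^ p.1 * x * u ^ p.2)).toNat
    obtain ⟨p, hp⟩ : ∃ p, ∀ q, f p ≤ f q := ⟨_, fun q => Function.argmin_le f q⟩
    refine ⟨p.1, p.2, fun i' j' => ?_⟩
    have : (ℓ (u ^ p.1 * x * u ^ p.2)).toNat ≤ (ℓ (u ^ i' * x * u ^ j')).toNat := hp (i', j')
    have := h.nonneg (u ^ i' * x * u ^ j')
    omega
  set y := u ^ i * x * u ^ j with hy
  have hfree : Function.Injective (FreeGroup.lift ![u ^ N, y * u ^ N * y⁻¹]) := by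
    rcases le_total (ℓ y) (3 * ℓ u) with hshort | hlong
    · refine h.injective_lift_of_short hu rfl hl hshort le_rfl hN fun k hk hc => hcomm k hk ?_
      have e1 : y * u * y⁻¹ = u ^ i * (x * u * x⁻¹) * (u ^ i)⁻¹ := by
        rw [hy]
        have : u ^ j * u * (u ^ j)⁻¹ = u := by group
        calc u ^ i * x * u ^ j * u * (u ^ i * x * u ^ j)⁻¹
            = u ^ i * x * (u ^ j * u * (u ^ j)⁻¹) * x⁻¹ * (u ^ i)⁻¹ := by group
          _ = _ := by rw [this]; group
      have e2 : u ^ k = u ^ i * u ^ k * (u ^ i)⁻¹ := by group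
      rw [e1, e2, Commute.conj_iff] at hc
      exact hc
    · refine h.injective_lift_of_long hu rfl hl hlong (by omega) fun i' j' => ?_
      have := hmin (i' + i) (j + j')
      rw [zpow_add, zpow_add] at this
      simpa [hy, mul_assoc] using this
  have e4 : u ^ N = u ^ i * u ^ N * (u ^ i)⁻¹ := by group
  have e5 : y * u ^ N * y⁻¹ = u ^ i * (x * u ^ N * x⁻¹) * (u ^ i)⁻¹ := by
    have : u ^ j * u ^ N * (u ^ j)⁻¹ = u ^ N := by group
    calc y * u ^ N * y⁻¹ = u ^ i * x * (u ^ j * u ^ N * (u ^ j)⁻¹) * x⁻¹ * (u ^ i)⁻¹ := by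
          rw [hy]
          group
      _ = _ := by rw [this]; group
  rw [e5] at hfree
  nth_rewrite 1 [e4] at hfree
  rwa [injective_lift_conj_iff] at hfree

end Free

end IsHyperbolicLength

end KCSA

namespace KCSA

/-! ### Groups that are virtually infinite cyclic -/

section Cyclic

variable {P : Type*} [Group P]

/-- The transfer to the central subgroup `⟨z⟩` is `x ↦ x ^ n`, with `n` its index. The kernel meets
`⟨z⟩` trivially, so it is finite, of order at most `K`. The centralizer of the kernel has index at
most `K!`, because the quotient acts faithfully on the kernel; it is abelian, being an extension of
a cyclic group by a central subgroup. -/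
theorem isKVirtuallyAbelian_of_central {z : P} (hz : z ∈ Subgroup.center P)
    (hinf : ¬ IsOfFinOrder z) [hfin : (Subgroup.zpowers z).FiniteIndex] {K : ℕ}
    (hK : ∀ F : Subgroup P, Finite F → Nat.card F ≤ K) : IsKVirtuallyAbelian K.factorial P := by
  have hcentral : ∀ w ∈ Subgroup.zpowers z, ∀ x : P, Commute x w := by
    rintro _ ⟨i, rfl⟩ x
    exact (show Commute x z from Subgroup.mem_center_iff.1 hz x).zpow_right i
  let : CommGroup (Subgroup.zpowers z) := IsCyclic.commGroup
  let f : P →* Subgroup.zpowers z := MonoidHom.transfer (MonoidHom.id (Subgroup.zpowers z))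
  have hf : ∀ x, (f x : P) = x ^ (Subgroup.zpowers z).index := by
    intro x
    have := MonoidHom.transfer_eq_pow (MonoidHom.id (Subgroup.zpowers z)) x (fun k g₀ hk => by
      have := (hcentral _ hk g₀).eq
      rw [← mul_assoc, mul_inv_cancel_left] at this
      exact (mul_right_cancel this).symm)
    exact congrArg Subtype.val this
  have hTfin : Finite f.ker := by
    refine Finite.of_injective (fun t : f.ker => ((t : P) : P ⧸ Subgroup.zpowers z)) ?_
    intro t t' htt
    obtain ⟨i, hi⟩ := QuotientGroup.eq.1 htt
    have hmem : (t : P)⁻¹ * t' ∈ f.ker := f.ker.mul_mem (f.ker.inv_mem t.2) t'.2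
    have h1 : ((t : P)⁻¹ * t') ^ (Subgroup.zpowers z).index = 1 := by
      rw [← hf, MonoidHom.mem_ker.1 hmem]
      rfl
    have h2 : z ^ (i * (Subgroup.zpowers z).index) = 1 := by
      rw [zpow_mul, zpow_natCast]
      simp only at hi
      rw [hi, h1]
    have h3 : i = 0 := by
      by_contra hi0
      refine hinf (isOfFinOrder_iff_zpow_eq_one.2 ⟨_, mul_ne_zero hi0 ?_, h2⟩)
      exact_mod_cast hfin.index_ne_zero
    rw [h3] at hi
    have : (t : P)⁻¹ * t' = 1 := by simpa using hi.symm
    exact Subtype.ext (inv_mul_eq_one.1 this)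
  refine ⟨(MulAut.conjNormal (H := f.ker)).ker, ?_, ?_, ?_⟩
  · set Q := (MulAut.conjNormal (H := f.ker)).ker with hQ
    have hcomm : ∀ x ∈ Q, ∀ t ∈ f.ker, x * t = t * x := by
      intro x hx t ht
      have := congrArg (fun φ : MulAut f.ker => ((φ ⟨t, ht⟩ : f.ker) : P)) (MonoidHom.mem_ker.1 hx)
      simp only [MulAut.conjNormal_apply, MulAut.one_apply] at this
      exact mul_inv_eq_iff_eq_mul.1 this
    have hker : (f.comp Q.subtype).ker ≤ Subgroup.center Q := by
      intro t ht
      rw [Subgroup.mem_center_iff]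
      intro x
      exact Subtype.ext (hcomm x x.2 t ht)
    have := (f.comp Q.subtype).isMulCommutative_of_isCyclic_of_ker_le_center hker
    intro a ha b hb
    exact congrArg Subtype.val (mul_comm' (⟨a, ha⟩ : Q) ⟨b, hb⟩)
  · have : Finite (MulAut f.ker) := Finite.of_injective _ MulEquiv.toEquiv_injective
    refine ⟨?_⟩
    rw [Subgroup.index_ker]
    exact Nat.card_pos.ne'
  · have : Finite (MulAut f.ker) := Finite.of_injective _ MulEquiv.toEquiv_injective
    rw [Subgroup.index_ker]
    calc Nat.card (MulAut.conjNormal (H := f.ker)).range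
        ≤ Nat.card (MulAut f.ker) := Nat.card_le_card_of_injective _ Subtype.val_injective
      _ ≤ Nat.card (Equiv.Perm f.ker) :=
          Nat.card_le_card_of_injective _ MulEquiv.toEquiv_injective
      _ = (Nat.card f.ker).factorial := Nat.card_perm
      _ ≤ K.factorial := Nat.factorial_le (hK _ hTfin)

/-- `E ∩ C` has index at most two in `E`; use two disjoint copies of the colours, translating the
second coset into `C`. -/
theorem isKVirtuallyAbelian_of_index_two {C E : Subgroup P} {K : ℕ}
    (hC : IsKVirtuallyAbelian K C) (hCE : ∀ x ∈ E, ∀ y ∈ E, x ∉ C → y ∉ C → x⁻¹ * y ∈ C) :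
    IsKVirtuallyAbelian (K + K) E := by
  classical
  obtain ⟨c, hc⟩ := isKVirtuallyAbelian_iff_colouring.1 hC
  by_cases hex : ∃ x₀ ∈ E, x₀ ∉ C
  swap
  · push Not at hex
    exact (hC.mono_subgroup hex).mono (Nat.le_add_left K K)
  obtain ⟨x₀, hx₀, hx₀C⟩ := hex
  let c' : E → Fin (K + K) := fun x => if hx : (x : P) ∈ C then Fin.castAdd K (c ⟨x, hx⟩) else
    Fin.natAdd K (c ⟨x₀⁻¹ * x, hCE x₀ hx₀ x x.2 hx₀C hx⟩)
  have key : ∀ x y : E, c' x = c' y →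
      ∃ a b : C, c a = c b ∧ ((a⁻¹ * b : C) : P) = (x : P)⁻¹ * y := by
    intro x y hxy
    by_cases hx : (x : P) ∈ C <;> by_cases hy : (y : P) ∈ C
    · simp only [c', hx, hy, dif_pos] at hxy
      exact ⟨_, _, Fin.castAdd_injective _ _ hxy, rfl⟩
    · simp only [c', hx, hy, dif_pos, dif_neg, not_false_eq_true] at hxy
      have := congrArg Fin.val hxy
      simp only [Fin.val_castAdd, Fin.val_natAdd] at this
      omega
    · simp only [c', hx, hy, dif_pos, dif_neg, not_false_eq_true] at hxy
      have := congrArg Fin.val hxy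
      simp only [Fin.val_castAdd, Fin.val_natAdd] at this
      omega
    · simp only [c', hx, hy, dif_neg, not_false_eq_true] at hxy
      refine ⟨_, _, Fin.natAdd_injective _ _ hxy, ?_⟩
      simp [mul_assoc]
  refine isKVirtuallyAbelian_iff_colouring.2 ⟨c', fun i j k l hij hkl => ?_⟩
  obtain ⟨a, b, hab, h1⟩ := key i j hij
  obtain ⟨a', b', hab', h2⟩ := key k l hkl
  have := congrArg Subtype.val (hc a b a' b' hab hab')
  refine Subtype.val_injective ?_
  simp only [id, commutatorElement_def, Subgroup.coe_mul, Subgroup.coe_inv, Subgroup.coe_one]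
    at this h1 h2 ⊢
  rw [← h1, ← h2]
  exact this

theorem finiteIndex_of_finite_cover {H : Subgroup P} {S : Set P} (hS : S.Finite)
    (hcover : ∀ x : P, ∃ s ∈ S, s⁻¹ * x ∈ H) : H.FiniteIndex := by
  choose f hfS hf using hcover
  have := hS.to_subtype
  have : Finite (P ⧸ H) := by
    refine Finite.of_injective (fun q : P ⧸ H => (⟨f q.out, hfS _⟩ : S)) fun q q' hq => ?_
    have h1 : f q.out = f q'.out := congrArg Subtype.val hq
    have h2 := H.mul_mem (H.inv_mem (hf q.out)) (h1 ▸ hf q'.out)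
    rw [mul_inv_rev, inv_inv, mul_assoc, mul_inv_cancel_left] at h2
    have : (q.out : P ⧸ H) = q'.out := QuotientGroup.eq.2 h2
    simpa using this
  exact Subgroup.finiteIndex_of_finite_quotient

/-- The elementary closure of an element `g` whose powers have almost cyclic centralizers and are
conjugate only to powers of the same exponent up to sign. -/
theorem exists_elementary_subgroup {g : P} (hg : ¬ IsOfFinOrder g) {K : ℕ}
    (hK : ∀ F : Subgroup P, Finite F → Nat.card F ≤ K) {B : Set P} (hB : B.Finite)
    (h1 : ∀ (x : P) (k : ℕ), 0 < k → Commute x (g ^ k) → ∃ b ∈ B, ∃ i j : ℤ, x = g ^ i * b * g ^ j)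
    (h2 : ∀ (x : P) (k : ℕ) (l : ℤ), 0 < k → x * g ^ k * x⁻¹ = g ^ l → l.natAbs = k) :
    ∃ E : Subgroup P, IsKVirtuallyAbelian (K.factorial + K.factorial) E ∧
      ∀ (x : P) (k : ℕ), 0 < k → conjComm g x k = 1 → x ∈ E := by
  classical
  have hgg : ∀ i j : ℤ, Commute (g ^ i) (g ^ j) := fun i j => (Commute.refl g).zpow_zpow i j
  obtain ⟨q, hq, hcent⟩ : ∃ q : ℕ, 0 < q ∧ ∀ (x : P) (k : ℕ), 0 < k → Commute x (g ^ k) →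
      Commute x (g ^ q) := by
    -- An element commuting with some `g ^ k` is `g ^ i * b * g ^ j` where `b` also commutes with `g
    -- ^ k`. As `b` ranges over a finite set, the product of one exponent for each `b` serves for
    -- all. The default `1` keeps the product positive.
    let f : P → ℕ := fun b => if h : ∃ k, 0 < k ∧ Commute b (g ^ k) then h.choose else 1
    have hf : ∀ b, 0 < f b := by
      intro b
      simp only [f]
      split_ifs with h
      · exact h.choose_spec.1
      · exact one_pos
    refine ⟨∏ b ∈ hB.toFinset, f b, Finset.prod_pos fun b _ => hf b, fun x k hk hx => ?_⟩
    obtain ⟨b, hb, i, j, rfl⟩ := h1 x k hk hx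
    have hbk : Commute b (g ^ k) := by
      have e : b = g ^ (-i) * (g ^ i * b * g ^ j) * g ^ (-j) := by group
      rw [e]
      rw [← zpow_natCast] at hx ⊢
      exact ((hgg _ _).mul_left hx).mul_left (hgg _ _)
    have hbf : Commute b (g ^ f b) := by
      have hex : ∃ k, 0 < k ∧ Commute b (g ^ k) := ⟨k, hk, hbk⟩
      simp only [f, dif_pos hex]
      exact hex.choose_spec.2
    obtain ⟨m, hm⟩ := Finset.dvd_prod_of_mem f (hB.mem_toFinset.2 hb)
    have hbq : Commute b (g ^ ∏ b ∈ hB.toFinset, f b) := by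
      rw [hm, pow_mul]
      exact hbf.pow_right m
    rw [← zpow_natCast] at hbq ⊢
    exact ((hgg _ _).mul_left hbq).mul_left (hgg _ _)
  set C : Subgroup P := Subgroup.centralizer {g ^ q} with hC
  have hmemC : ∀ x, x ∈ C ↔ Commute x (g ^ q) := by
    intro x
    rw [hC, Subgroup.mem_centralizer_singleton_iff]
    exact ⟨fun h => h, fun h => h⟩
  have hgC : g ∈ C := (hmemC g).2 (Commute.self_pow g q)
  let z : C := ⟨g ^ q, C.pow_mem hgC q⟩
  have hzc : z ∈ Subgroup.center C := by
    rw [Subgroup.mem_center_iff]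
    exact fun x => Subtype.ext ((hmemC x).1 x.2)
  have hzinf : ¬ IsOfFinOrder z := by
    exact fun hz => not_isOfFinOrder_pow hg hq (C.subtype.isOfFinOrder hz)
  have hfin : (Subgroup.zpowers z).FiniteIndex := by
    -- Since `g ^ q` is central in `C`, the exponents `i` and `j` can be reduced modulo `q`, leaving
    -- finitely many coset representatives.
    have hS : ((fun p : ℤ × P × ℤ => g ^ p.1 * p.2.1 * g ^ p.2.2) ''
        (Set.Ico (0 : ℤ) q ×ˢ B ×ˢ Set.Ico (0 : ℤ) q)).Finite :=
      ((Set.finite_Ico _ _).prod (hB.prod (Set.finite_Ico _ _))).image _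
    refine finiteIndex_of_finite_cover (hS.preimage (f := ((↑) : C → P))
      Subtype.val_injective.injOn) fun x => ?_
    obtain ⟨b, hb, i, j, hx⟩ := h1 x q hq ((hmemC _).1 x.2)
    have hbq : Commute b (g ^ (q : ℤ)) := by
      have e : b = g ^ (-i) * x * g ^ (-j) := by rw [hx]; group
      rw [e]
      have := (hmemC _).1 x.2
      rw [← zpow_natCast] at this
      exact ((hgg _ _).mul_left this).mul_left (hgg _ _)
    set i₀ := i % q with hi₀
    set j₀ := j % q with hj₀
    have hi : i = q * (i / q) + i₀ := (Int.mul_ediv_add_emod i q).symm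
    have hj : j = j₀ + q * (j / q) := (Int.emod_add_mul_ediv j q).symm
    have hq' : (q : ℤ) ≠ 0 := by exact_mod_cast hq.ne'
    have hq0 : (0 : ℤ) < q := by exact_mod_cast hq
    have hbC : b ∈ C := (hmemC b).2 (by rwa [zpow_natCast] at hbq)
    refine ⟨⟨g ^ i₀ * b * g ^ j₀, C.mul_mem (C.mul_mem (C.zpow_mem hgC _) hbC)
      (C.zpow_mem hgC _)⟩, ⟨(i₀, b, j₀), ⟨⟨Int.emod_nonneg _ hq', Int.emod_lt_of_pos _ hq0⟩, hb,
        Int.emod_nonneg _ hq', Int.emod_lt_of_pos _ hq0⟩, rfl⟩, i / q + j / q, ?_⟩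
    refine Subtype.ext ?_
    have e1 : ((z ^ (i / q + j / q) : C) : P) = g ^ (q * (i / q)) * g ^ (q * (j / q)) := by
      simp only [z, Subgroup.coe_zpow]
      rw [← zpow_natCast, ← zpow_mul, mul_add, zpow_add]
    have c1 : Commute (g ^ i₀ * b * g ^ j₀) (g ^ (q * (i / q))) := by
      refine ((hgg _ _).mul_left ?_).mul_left (hgg _ _)
      rw [zpow_mul]
      exact hbq.zpow_right _
    simp only [Subgroup.coe_mul, Subgroup.coe_inv]
    rw [e1, hx]
    rw [eq_inv_mul_iff_mul_eq]
    conv_rhs => rw [hi, hj, zpow_add, zpow_add]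
    rw [← mul_assoc, c1.eq]
    simp only [mul_assoc]
  have hKC : IsKVirtuallyAbelian K.factorial C := by
    refine isKVirtuallyAbelian_of_central hzc hzinf fun F hF => ?_
    have e := F.equivMapOfInjective C.subtype Subtype.val_injective
    rw [Nat.card_congr e.toEquiv]
    exact hK _ (Finite.of_equiv _ e.toEquiv)
  -- `E` consists of the elements that fix or invert some power of `g`. Those that fix one lie in
  -- `C`, and the quotient of two that invert fixes a common power.
  let R : ℕ → P → Prop := fun k x => x * g ^ k * x⁻¹ = g ^ k ∨ x * g ^ k * x⁻¹ = (g ^ k)⁻¹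
  have hR : ∀ k l x, R k x → R (k * l) x := by
    rintro k l x (h | h)
    · left
      rw [pow_mul, ← conj_pow, h]
    · right
      rw [pow_mul, ← conj_pow, h, inv_pow]
  have hRmul : ∀ k x y, R k x → R k y → R k (x * y) := by
    intro k x y hx hy
    have e : x * y * g ^ k * (x * y)⁻¹ = x * (y * g ^ k * y⁻¹) * x⁻¹ := by group
    have e' : x * (g ^ k)⁻¹ * x⁻¹ = (x * g ^ k * x⁻¹)⁻¹ := by group
    rcases hx with hx | hx <;> rcases hy with hy | hy
    · exact Or.inl (by rw [e, hy, hx])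
    · exact Or.inr (by rw [e, hy, e', hx])
    · exact Or.inr (by rw [e, hy, hx])
    · exact Or.inl (by rw [e, hy, e', hx, inv_inv])
  have hRinv : ∀ k x, R k x → R k x⁻¹ := by
    rintro k x (h | h)
    · left
      nth_rewrite 1 [← h]
      group
    · right
      have e : x⁻¹ * g ^ k * x⁻¹⁻¹ = (x⁻¹ * (g ^ k)⁻¹ * x)⁻¹ := by group
      have e2 : x⁻¹ * (x * g ^ k * x⁻¹) * x = g ^ k := by group
      rw [h] at e2
      rw [e, e2]
  let E : Subgroup P :=
    { carrier := {x | ∃ k, 0 < k ∧ R k x}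
      mul_mem' := by
        rintro x y ⟨k, hk, hx⟩ ⟨l, hl, hy⟩
        exact ⟨k * l, Nat.mul_pos hk hl, hRmul _ _ _ (hR _ _ _ hx)
          (by rw [mul_comm]; exact hR _ _ _ hy)⟩
      one_mem' := ⟨1, one_pos, Or.inl (by simp)⟩
      inv_mem' := by
        rintro x ⟨k, hk, hx⟩
        exact ⟨k, hk, hRinv _ _ hx⟩ }
  have hCof : ∀ x k, 0 < k → x * g ^ k * x⁻¹ = g ^ k → x ∈ C := fun x k hk hx =>
    (hmemC x).2 (hcent x k hk (mul_inv_eq_iff_eq_mul.1 hx))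
  refine ⟨E, isKVirtuallyAbelian_of_index_two hKC ?_, ?_⟩
  · rintro x ⟨k, hk, hx⟩ y ⟨l, hl, hy⟩ hxC hyC
    have hx' := hR k l x hx
    have hy' := hR l k y hy
    rw [mul_comm] at hy'
    have hkl := Nat.mul_pos hk hl
    have hx2 : x * g ^ (k * l) * x⁻¹ = (g ^ (k * l))⁻¹ :=
      hx'.resolve_left fun h => hxC (hCof x _ hkl h)
    have hy2 : y * g ^ (k * l) * y⁻¹ = (g ^ (k * l))⁻¹ :=
      hy'.resolve_left fun h => hyC (hCof y _ hkl h)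
    refine hCof _ _ hkl ?_
    calc x⁻¹ * y * g ^ (k * l) * (x⁻¹ * y)⁻¹ = x⁻¹ * (y * g ^ (k * l) * y⁻¹) * x := by group
      _ = x⁻¹ * (x * g ^ (k * l) * x⁻¹) * x := by rw [hy2, hx2]
      _ = g ^ (k * l) := by group
  · intro x k hk hx
    rw [conjComm_eq_one_iff] at hx
    -- The conjugate lies in `C`, in which `⟨g ^ q⟩` has finite index, so a power of it is a power
    -- of `g`; by `h2` the exponents agree up to sign.
    have hyC : x * g ^ k * x⁻¹ ∈ C := (hmemC _).2 (hcent _ k hk hx)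
    obtain ⟨n, hn, -, t, ht⟩ := Subgroup.exists_pow_mem_of_index_ne_zero hfin.index_ne_zero
      (⟨x * g ^ k * x⁻¹, hyC⟩ : C)
    have ht' : x * g ^ (k * n) * x⁻¹ = g ^ (q * t : ℤ) := by
      have := congrArg Subtype.val ht
      simp only [z, Subgroup.coe_zpow, Subgroup.coe_pow, conj_pow, ← pow_mul] at this
      rw [← this, zpow_mul, zpow_natCast]
    have hkn := Nat.mul_pos hk hn
    have habs := h2 x (k * n) _ hkn ht'
    refine ⟨k * n, hkn, ?_⟩
    rcases Int.natAbs_eq (q * t : ℤ) with he | he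
    · left
      rw [ht', he, habs, zpow_natCast]
    · right
      rw [ht', he, habs, zpow_neg, zpow_natCast]

end Cyclic

end KCSA

namespace KCSA

/-! ### The word metric of a hyperbolic group -/

section WordMetric

variable {G : Type*} [Group G] {S : Set G}

theorem wordLength_le {g : G} {l : List G} (hl : ∀ x ∈ l, x ∈ S ∨ x⁻¹ ∈ S) (hg : l.prod = g) :
    wordLength S g ≤ l.length :=
  Nat.sInf_le ⟨l, hl, hg, rfl⟩

theorem exists_word (hS : Subgroup.closure S = ⊤) (g : G) :
    ∃ l : List G, (∀ x ∈ l, x ∈ S ∨ x⁻¹ ∈ S) ∧ l.prod = g ∧ l.length = wordLength S g := by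
  obtain ⟨l, hl, hg⟩ := Submonoid.exists_list_of_mem_closure (s := S ∪ S⁻¹) (x := g) (by
    rw [← Subgroup.closure_toSubmonoid, hS]
    trivial)
  exact Nat.sInf_mem (s := {n : ℕ | ∃ l : List G, (∀ x ∈ l, x ∈ S ∨ x⁻¹ ∈ S) ∧ l.prod = g ∧
    l.length = n}) ⟨_, l, hl, hg, rfl⟩

theorem finite_setOf_word (hS : S.Finite) (n : ℕ) :
    {g : G | ∃ l : List G, (∀ x ∈ l, x ∈ S ∨ x⁻¹ ∈ S) ∧ l.prod = g ∧ l.length = n}.Finite := by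
  induction n with
  | zero =>
    refine (Set.finite_singleton 1).subset ?_
    rintro _ ⟨l, -, rfl, hl⟩
    simp [List.length_eq_zero_iff.1 hl]
  | succ n ih =>
    have hfin : {x : G | x ∈ S ∨ x⁻¹ ∈ S}.Finite :=
      hS.union (hS.preimage inv_injective.injOn)
    refine (hfin.mul ih).subset ?_
    rintro _ ⟨l, hl, rfl, hn⟩
    rcases l with _ | ⟨a, l⟩
    · simp at hn
    · rw [List.prod_cons]
      exact Set.mul_mem_mul (hl a (by simp))
        ⟨l, fun x hx => hl x (by simp [hx]), rfl, by simpa using hn⟩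

theorem wordLength_inv_le (hS : Subgroup.closure S = ⊤) (g : G) :
    wordLength S g⁻¹ ≤ wordLength S g := by
  obtain ⟨l, hl, hg, hn⟩ := exists_word hS g
  rw [← hn, ← List.length_reverse, ← List.length_map (f := fun x : G => x⁻¹), ← hg]
  refine wordLength_le (fun x hx => ?_) ?_
  · simp only [List.mem_map, List.mem_reverse] at hx
    obtain ⟨y, hy, rfl⟩ := hx
    simpa using (hl y hy).symm
  · rw [List.prod_inv_reverse, List.map_reverse]

theorem wordLength_mul_le (hS : Subgroup.closure S = ⊤) (g g' : G) :
    wordLength S (g * g') ≤ wordLength S g + wordLength S g' := by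
  obtain ⟨l, hl, hg, hn⟩ := exists_word hS g
  obtain ⟨l', hl', hg', hn'⟩ := exists_word hS g'
  rw [← hn, ← hn', ← List.length_append]
  refine wordLength_le (fun x hx => ?_) (by rw [List.prod_append, hg, hg'])
  rcases List.mem_append.1 hx with hx | hx
  · exact hl x hx
  · exact hl' x hx

theorem IsHyperbolicGroup.exists_isHyperbolicLength (hG : IsHyperbolicGroup G) :
    ∃ (ℓ : G → ℤ) (D : ℤ), IsHyperbolicLength ℓ D := by
  obtain ⟨S, hfin, hS, δ, hδ⟩ := hG
  refine ⟨fun g => wordLength S g, 2 * δ, ?_, fun x => ?_, fun x y => ?_, fun n => ?_,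
    fun x r hr hrx => ?_, fun x y z w => ?_⟩
  · have := wordLength_le (S := S) (l := []) (by simp) rfl
    simpa using this
  · have h1 := wordLength_inv_le hS x
    have h2 := wordLength_inv_le hS x⁻¹
    rw [inv_inv] at h2
    exact_mod_cast le_antisymm h1 h2
  · exact_mod_cast wordLength_mul_le hS x y
  · refine ((Set.finite_Iic n.toNat).biUnion fun m _ => finite_setOf_word hfin m).subset ?_
    intro x hx
    have hx : (wordLength S x : ℤ) ≤ n := hx
    exact Set.mem_biUnion (show wordLength S x ∈ Set.Iic n.toNat from by
      rw [Set.mem_Iic]; omega) (exists_word hS x)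
  -- Cut a shortest word after `k` letters: neither piece can be shortened, since the lengths must
  -- add up to at least that of `x`.
  · obtain ⟨l, hl, hg, hn⟩ := exists_word hS x
    obtain ⟨k, rfl⟩ := Int.eq_ofNat_of_zero_le hr
    have h1 := wordLength_le (S := S) (l := l.take k) (fun x hx => hl x (List.mem_of_mem_take hx))
      rfl
    have h2 := wordLength_le (S := S) (l := l.drop k) (fun x hx => hl x (List.mem_of_mem_drop hx))
      rfl
    have e : (l.take k).prod⁻¹ * x = (l.drop k).prod := by
      rw [← hg, ← List.prod_take_mul_prod_drop l k, inv_mul_cancel_left]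
    have h3 := wordLength_mul_le hS (l.take k).prod ((l.take k).prod⁻¹ * x)
    rw [mul_inv_cancel_left] at h3
    rw [List.length_take] at h1
    rw [List.length_drop] at h2
    refine ⟨(l.take k).prod, ?_, ?_⟩
    · rw [e] at h3
      omega
    · rw [e] at h3 ⊢
      omega
  · have := hδ x y z w
    simp only [wordDist] at this
    exact_mod_cast this

end WordMetric

end KCSA

namespace KCSA

open scoped commutatorElement

theorem card_le_of_forall_finset {G : Type*} [Group G] {K : ℕ} (hK : ∀ X : Finset G, K < X.card →
    ∃ u, (u ∈ X ∨ ∃ x ∈ X, ∃ y ∈ X, u = x * y) ∧ ¬ IsOfFinOrder u)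
    (F : Subgroup G) (hF : Finite F) : Nat.card F ≤ K := by
  by_contra! hlt
  have hfin : (F : Set G).Finite := hF
  obtain ⟨u, hu, hinf⟩ := hK hfin.toFinset (by
    rwa [← Nat.card_eq_card_finite_toFinset hfin])
  have huF : u ∈ F := by
    simp only [Set.Finite.mem_toFinset, SetLike.mem_coe] at hu
    rcases hu with hu | ⟨x, hx, y, hy, rfl⟩
    · exact hu
    · exact F.mul_mem hx hy
  exact hinf (F.subtype.isOfFinOrder (isOfFinOrder_of_finite (⟨u, huF⟩ : F)))

namespace IsHyperbolicLength

variable {G : Type*} [Group G] {ℓ : G → ℤ} {D : ℤ}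

/-! ### Uniform constants for a hyperbolic group -/

section Uniform

variable (h : IsHyperbolicLength ℓ D)
include h

theorem not_isOfFinOrder_of_growth {a : ℤ} (ha : 0 < a) {u y : G}
    (hu : ∀ k : ℕ, a * k ≤ ℓ (y⁻¹ * u ^ k * y)) : ¬ IsOfFinOrder u := by
  intro hfin
  obtain ⟨n, hn, hun⟩ := isOfFinOrder_iff_pow_eq_one.1 hfin
  have := hu n
  rw [hun, mul_one, inv_mul_cancel, h.one] at this
  have : 0 < a * n := mul_pos ha (by exact_mod_cast hn)
  omega

/-- A large finite set contains an element of infinite order, up to taking products of two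
elements. -/
theorem exists_not_isOfFinOrder : ∃ K : ℕ, ∀ X : Finset G, K < X.card →
    ∃ u, (u ∈ X ∨ ∃ x ∈ X, ∃ y ∈ X, u = x * y) ∧ ¬ IsOfFinOrder u := by
  obtain ⟨K, hK⟩ := h.exists_growth one_pos
  refine ⟨K, fun X hX => ?_⟩
  obtain ⟨u, hu, y, hy⟩ := hK X hX
  exact ⟨u, hu, h.not_isOfFinOrder_of_growth one_pos hy⟩

/-- A bounded power of an element of infinite order has, up to conjugation, a long axis. -/
theorem exists_isAxial : ∃ J : ℕ, ∀ g : G, ¬ IsOfFinOrder g → ∃ j, 0 < j ∧ j ≤ J ∧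
    ∃ y, IsAxial ℓ (6 * D + 2) (y⁻¹ * g ^ j * y) ∧
      20 * (6 * D + 2) + 20 * D + 20 ≤ ℓ (y⁻¹ * g ^ j * y) := by
  classical
  have hD := h.const_nonneg
  obtain ⟨K, hK⟩ := h.exists_growth (a := 20 * (6 * D + 2) + 20 * D + 20) (by omega)
  refine ⟨(K + 1) + (K + 1), fun g hg => ?_⟩
  have hinj : Function.Injective fun i : ℕ => g ^ (i + 1) :=
    (injective_pow_iff_not_isOfFinOrder.2 hg).comp (add_left_injective 1)
  -- Among `g, …, g ^ (K + 1)` and their pairwise products, all of which are powers of `g` with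
  -- exponent at most `2 * K + 2`, one grows fast.
  obtain ⟨u, hu, z, hz⟩ := hK ((Finset.range (K + 1)).image fun i => g ^ (i + 1)) (by
    rw [Finset.card_image_of_injective _ hinj]
    simp)
  obtain ⟨j, hj, hjK, rfl⟩ : ∃ j, 0 < j ∧ j ≤ (K + 1) + (K + 1) ∧ u = g ^ j := by
    simp only [Finset.mem_image, Finset.mem_range] at hu
    rcases hu with ⟨i, hi, rfl⟩ | ⟨_, ⟨i, hi, rfl⟩, _, ⟨i', hi', rfl⟩, rfl⟩
    · exact ⟨i + 1, by omega, by omega, rfl⟩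
    · exact ⟨i + 1 + (i' + 1), by omega, by omega, by rw [← pow_add]⟩
  refine ⟨j, hj, hjK, ?_⟩
  let f : G → ℕ := fun y => (ℓ (y⁻¹ * g ^ j * y)).toNat
  obtain ⟨y, hy⟩ : ∃ y, ∀ x, f y ≤ f x := ⟨_, fun x => Function.argmin_le f x⟩
  have hmin : ∀ x, ℓ (y⁻¹ * g ^ j * y) ≤ ℓ (x⁻¹ * (y⁻¹ * g ^ j * y) * x) := by
    intro x
    have h1 : (ℓ (y⁻¹ * g ^ j * y)).toNat ≤ (ℓ ((y * x)⁻¹ * g ^ j * (y * x))).toNat := hy (y * x)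
    have h2 := h.nonneg ((y * x)⁻¹ * g ^ j * (y * x))
    rw [show x⁻¹ * (y⁻¹ * g ^ j * y) * x = (y * x)⁻¹ * g ^ j * (y * x) by group]
    omega
  have hlong : 20 * (6 * D + 2) + 20 * D + 20 ≤ ℓ (y⁻¹ * g ^ j * y) := by
    -- Changing the base point from `z` to `y` alters lengths by at most `2 * c`. A length below the
    -- growth rate would lose at least one unit per power, contradicting `hz` at `n = 2 * c + 1`.
    by_contra! hlt
    set c := ℓ (z⁻¹ * y) with hc
    have hc0 := h.nonneg (z⁻¹ * y)
    obtain ⟨n, hn⟩ := Int.eq_ofNat_of_zero_le (show 0 ≤ 2 * c + 1 by omega)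
    have h1 := hz n
    have h2 := h.length_pow_le (y⁻¹ * g ^ j * y) n
    have h3 := h.mul_le ((z⁻¹ * y) * (y⁻¹ * g ^ j * y) ^ n) (z⁻¹ * y)⁻¹
    have h4 := h.mul_le (z⁻¹ * y) ((y⁻¹ * g ^ j * y) ^ n)
    have e : (z⁻¹ * y) * (y⁻¹ * g ^ j * y) ^ n * (z⁻¹ * y)⁻¹ = z⁻¹ * (g ^ j) ^ n * z := by
      have e1 : (y⁻¹ * g ^ j * y) ^ n = y⁻¹ * (g ^ j) ^ n * y := by
        simpa using conj_pow (i := n) (a := y⁻¹) (b := g ^ j)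
      rw [e1]
      group
    rw [e, h.inv] at h3
    have h5 : (n : ℤ) * ℓ (y⁻¹ * g ^ j * y) ≤ n * (20 * (6 * D + 2) + 20 * D + 20 - 1) :=
      mul_le_mul_of_nonneg_left (by omega) (by omega)
    have h6 : (20 * (6 * D + 2) + 20 * D + 20) * (n : ℤ) =
        n * (20 * (6 * D + 2) + 20 * D + 20 - 1) + n := by ring
    omega
  refine ⟨y, h.isAxial_of_length_sq (h.length_sq_of_conj_minimal hmin ?_) ?_, hlong⟩ <;> omega

/-- Conjugation by `x` changes lengths by at most `2 * ℓ x`, while the lengths of `u ^ (a * n)` and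
`u ^ (|l| * n)` drift apart as `n` grows unless `|l| = a`. -/
theorem IsAxial.natAbs_eq {e : ℤ} {u x : G} (hu : IsAxial ℓ e u) (heu : e < ℓ u) {a : ℕ} {l : ℤ}
    (hx : x * u ^ a * x⁻¹ = u ^ l) : l.natAbs = a := by
  have he := IsAxial.nonneg h hu
  have hgrow : ∀ n : ℕ, (n : ℤ) ≤ ℓ (u ^ n) := by
    intro n
    have := IsAxial.mul_le h hu n
    nlinarith
  have hx0 := h.nonneg x
  have hconj : ∀ n : ℕ, ℓ (u ^ (l.natAbs * n)) ≤ ℓ (u ^ (a * n)) + 2 * ℓ x ∧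
      ℓ (u ^ (a * n)) ≤ ℓ (u ^ (l.natAbs * n)) + 2 * ℓ x := by
    intro n
    have h1 : ℓ (u ^ (l.natAbs * n)) = ℓ (x * u ^ (a * n) * x⁻¹) := by
      have e1 : x * u ^ (a * n) * x⁻¹ = (u ^ l) ^ n := by rw [pow_mul, ← conj_pow, hx]
      rw [e1, pow_mul]
      rcases Int.natAbs_eq l with hl | hl
      · nth_rewrite 2 [hl]
        rw [zpow_natCast]
      · nth_rewrite 2 [hl]
        rw [zpow_neg, zpow_natCast, inv_pow, h.inv]
    rw [h1]
    have h2 := h.mul_le (x * u ^ (a * n)) x⁻¹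
    have h3 := h.mul_le x (u ^ (a * n))
    have h4 := h.mul_le (x⁻¹ * (x * u ^ (a * n) * x⁻¹)) x
    have h5 := h.mul_le x⁻¹ (x * u ^ (a * n) * x⁻¹)
    rw [show x⁻¹ * (x * u ^ (a * n) * x⁻¹) * x = u ^ (a * n) by group] at h4
    rw [h.inv] at h2 h5
    omega
  have key : ∀ b d : ℕ, 0 < d →
      ¬ ∀ n : ℕ, ℓ (u ^ ((b + d) * n)) ≤ ℓ (u ^ (b * n)) + 2 * ℓ x := by
    intro b d hd hle
    obtain ⟨n, hn⟩ := Int.eq_ofNat_of_zero_le (show 0 ≤ 2 * ℓ x + e + 1 by omega)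
    have h1 := hle n
    have h2 := hu (b * n) (d * n)
    have h3 := hgrow (d * n)
    rw [← add_mul] at h2
    have h4 : (n : ℤ) ≤ ((d * n : ℕ) : ℤ) := by exact_mod_cast Nat.le_mul_of_pos_left n hd
    omega
  rcases lt_trichotomy l.natAbs a with hlt | heq | hlt
  · obtain ⟨d, hd⟩ := Nat.exists_eq_add_of_lt hlt
    exact (key l.natAbs (d + 1) (by omega) fun n => by
      rw [← add_assoc, ← hd]
      exact (hconj n).2).elim
  · exact heq
  · obtain ⟨d, hd⟩ := Nat.exists_eq_add_of_lt hlt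
    exact (key a (d + 1) (by omega) fun n => by
      rw [← add_assoc, ← hd]
      exact (hconj n).1).elim

/-- `exists_elementary_subgroup` is applied to `g` itself; its hypotheses are read off the
quasi-axis of a conjugate of `g ^ j`. In the constant, `K! + K!` serves the maximal subgroups and
the last `K` the finite ones. -/
theorem isKCSA {K : ℕ} (hK : ∀ F : Subgroup G, Finite F → Nat.card F ≤ K) :
    IsKCSA (K.factorial + K.factorial + K) G := by
  have hD := h.const_nonneg
  obtain ⟨J, hJ⟩ := h.exists_isAxial
  refine IsKCSA.of_subgroups (fun F hF => (hK F hF).trans (Nat.le_add_left _ _)) fun g hg => ?_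
  obtain ⟨j, hj, -, y, hax, hlong⟩ := hJ g hg
  set u := y⁻¹ * g ^ j * y with hu
  have hpow : ∀ n : ℕ, u ^ n = y⁻¹ * g ^ (j * n) * y := by
    intro n
    rw [pow_mul]
    simpa using conj_pow (i := n) (a := y⁻¹) (b := g ^ j)
  have hzpow : ∀ n : ℤ, u ^ n = y⁻¹ * g ^ (j * n : ℤ) * y := by
    intro n
    rw [zpow_mul, zpow_natCast]
    simpa using conj_zpow (i := n) (a := y⁻¹) (b := g ^ j)
  suffices hE : ∃ E : Subgroup G, IsKVirtuallyAbelian (K.factorial + K.factorial) E ∧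
      ∀ x k, 0 < k → conjComm g x k = 1 → x ∈ E by
    obtain ⟨E, hE, hmem⟩ := hE
    exact ⟨E, hE.mono (Nat.le_add_right _ _), hmem⟩
  refine exists_elementary_subgroup hg hK
    ((h.finite_ball (2 * (6 * D + 2) + 4 * D + 2 * ℓ u)).image fun b => y * b * y⁻¹) ?_ ?_
  · intro x k hk hx
    have hx' : Commute (y⁻¹ * x * y) (u ^ k) := by
      have h1 : Commute x (g ^ (j * k)) := by
        rw [mul_comm, pow_mul]
        exact hx.pow_right j
      have h2 := (Commute.conj_iff y⁻¹).2 h1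
      rw [hpow]
      simpa using h2
    obtain ⟨i, i', hb⟩ := IsAxial.exists_length_le_of_commute h hax (by omega) hk hx'
    refine ⟨_, ⟨_, hb, rfl⟩, j * i', -(j * i), ?_⟩
    have e1 := hpow i
    have e2 := hpow i'
    rw [e1, e2]
    group
  · intro x k l hk hx
    refine IsAxial.natAbs_eq h hax (by omega) (x := y⁻¹ * x * y) (a := k) (l := l) ?_
    have hx' : x * g ^ (j * k) * x⁻¹ = g ^ (j * l : ℤ) := by
      rw [mul_comm, pow_mul, ← conj_pow, hx, mul_comm (j : ℤ), zpow_mul, zpow_natCast]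
    rw [hpow, hzpow, ← hx']
    group

/-- The exponent `j` giving `g ^ j` a long axis depends on `g`, but it divides `J!`. The free pair
criterion holds for every large enough exponent, hence for a multiple that turns `j` into `J!`. -/
theorem exists_injective_lift : ∃ N : ℕ, ∀ g x : G, ¬ IsOfFinOrder g →
    (∀ k, 0 < k → conjComm g x k ≠ 1) →
    Function.Injective (FreeGroup.lift ![g ^ N, x * g ^ N * x⁻¹]) := by
  obtain ⟨J, hJ⟩ := h.exists_isAxial
  set N := 4 * (h.finite_ball (7 * (6 * D + 2) + 17 * D)).toFinset.card + 200 with hN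
  refine ⟨J.factorial * N, fun g x hg hx => ?_⟩
  obtain ⟨j, hj, hjJ, y, hax, hlong⟩ := hJ g hg
  obtain ⟨m, hm⟩ := Nat.dvd_factorial hj hjJ
  have hm0 : 0 < m := by
    rcases Nat.eq_zero_or_pos m with rfl | hm0
    · exact absurd hm J.factorial_pos.ne'
    · exact hm0
  set u := y⁻¹ * g ^ j * y with hu
  have hpow : ∀ n : ℕ, u ^ n = y⁻¹ * g ^ (j * n) * y := by
    intro n
    rw [pow_mul]
    simpa using conj_pow (i := n) (a := y⁻¹) (b := g ^ j)
  have hfree := h.injective_lift_of_axial hax hlong (x := y⁻¹ * x * y) (N := m * N)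
    (Nat.le_mul_of_pos_left N hm0) (fun k hk hc => by
      refine hx (j * k) (Nat.mul_pos hj hk) ?_
      have h1 := hc.pow_right k
      rw [conj_pow, hpow] at h1
      have e1 : y⁻¹ * x * y * (y⁻¹ * g ^ (j * k) * y) * (y⁻¹ * x * y)⁻¹ =
        y⁻¹ * (x * g ^ (j * k) * x⁻¹) * y⁻¹⁻¹ := by group
      have e2 : y⁻¹ * g ^ (j * k) * y = y⁻¹ * g ^ (j * k) * y⁻¹⁻¹ := by group
      rw [e1, e2, Commute.conj_iff] at h1
      exact conjComm_eq_one_iff.2 h1.symm)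
  rw [← injective_lift_conj_iff _ _ y, hpow] at hfree
  have e1 : y * (y⁻¹ * g ^ (j * (m * N)) * y) * y⁻¹ = g ^ (J.factorial * N) := by
    rw [hm, mul_assoc j]
    group
  have e2 : y * (y⁻¹ * x * y * (y⁻¹ * g ^ (j * (m * N)) * y) * (y⁻¹ * x * y)⁻¹) * y⁻¹ =
      x * g ^ (J.factorial * N) * x⁻¹ := by
    rw [hm, mul_assoc j]
    group
  rwa [e1, e2] at hfree

end Uniform

end IsHyperbolicLength

/-! ### Limit groups over hyperbolic groups -/

section Limit

/-- Among `n` distinct elements and their products, there is one whose `k`-th power is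
nontrivial. -/
def infiniteOrderCondition (n k : ℕ) (S : Set (FreeGroup (Fin n))) : Prop :=
  (∀ i j, FreeGroup.of i * (FreeGroup.of j)⁻¹ ∈ S → i = j) →
    (∃ i, FreeGroup.of i ^ k ∉ S) ∨ ∃ i j, (FreeGroup.of i * FreeGroup.of j) ^ k ∉ S

/-- If powers of `g` and of `x * g * x⁻¹` do not commute, then a given word in other powers is
nontrivial. -/
def freeCondition (k N : ℕ) (w : FreeGroup (Fin 2)) (S : Set (FreeGroup (Fin 2))) : Prop :=
  conjComm (FreeGroup.of 0) (FreeGroup.of 1) k ∉ S →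
    FreeGroup.lift ![FreeGroup.of 0 ^ N, FreeGroup.of 1 * FreeGroup.of 0 ^ N *
      (FreeGroup.of 1)⁻¹] w ∉ S

theorem isLocal_infiniteOrderCondition (n k : ℕ) : IsLocal (infiniteOrderCondition n k) :=
  (IsLocal.forall_finite fun _ => IsLocal.forall_finite fun _ =>
    (IsLocal.mem _).imp (IsLocal.const _)).imp
      ((IsLocal.exists_finite fun _ => (IsLocal.mem _).not).or
        (IsLocal.exists_finite fun _ => IsLocal.exists_finite fun _ => (IsLocal.mem _).not))

theorem isLocal_freeCondition (k N : ℕ) (w : FreeGroup (Fin 2)) :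
    IsLocal (freeCondition k N w) :=
  (IsLocal.mem _).not.imp (IsLocal.mem _).not

variable {G : Type*} [Group G]

theorem satisfies_infiniteOrderCondition {n k : ℕ} : Satisfies G (infiniteOrderCondition n k) ↔
    ∀ x : Fin n → G, Function.Injective x →
      (∃ i, x i ^ k ≠ 1) ∨ ∃ i j, (x i * x j) ^ k ≠ 1 := by
  simp [Satisfies, infiniteOrderCondition, mul_inv_eq_one, Function.Injective]

theorem satisfies_freeCondition {k N : ℕ} {w : FreeGroup (Fin 2)} :
    Satisfies G (freeCondition k N w) ↔ ∀ g x : G, conjComm g x k ≠ 1 →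
      FreeGroup.lift ![g ^ N, x * g ^ N * x⁻¹] w ≠ 1 := by
  have key : ∀ y : Fin 2 → G, FreeGroup.lift y (FreeGroup.lift ![FreeGroup.of 0 ^ N,
      FreeGroup.of 1 * FreeGroup.of 0 ^ N * (FreeGroup.of 1)⁻¹] w) =
      FreeGroup.lift ![y 0 ^ N, y 1 * y 0 ^ N * (y 1)⁻¹] w := by
    intro y
    have : (FreeGroup.lift y).comp (FreeGroup.lift ![FreeGroup.of 0 ^ N,
        FreeGroup.of 1 * FreeGroup.of 0 ^ N * (FreeGroup.of 1)⁻¹]) =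
        FreeGroup.lift ![y 0 ^ N, y 1 * y 0 ^ N * (y 1)⁻¹] := by
      ext i
      fin_cases i <;> simp
    rw [← this]
    rfl
  simp only [Satisfies, freeCondition, Set.mem_ofPred_eq, map_conjComm, FreeGroup.lift_apply_of,
    key]
  exact ⟨fun h g x => h ![g, x], fun h x => h _ _⟩

/-- The Tits alternative, from the universal conditions above. -/
theorem IsKCSA.containsFreeGroupTwo_or {K K₀ N : ℕ} (hK : IsKCSA K G) (hK₀ : K₀ ≤ K)
    (h1 : Satisfies G (infiniteOrderCondition (K₀ + 1) K.factorial))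
    (h2 : ∀ w, w ≠ 1 → Satisfies G (freeCondition K.factorial N w)) (H : Subgroup G) :
    ContainsFreeGroupTwo H ∨ IsKVirtuallyAbelian K H := by
  by_cases htors : ∀ x ∈ H, x ^ K.factorial = 1
  · right
    -- Here `H` is torsion, and `K₀ + 1` distinct elements would produce one of infinite order. So
    -- `H` has at most `K₀` elements, and the trivial subgroup has small index.
    have hno : ¬ Nonempty (Fin (K₀ + 1) ↪ H) := by
      rintro ⟨x⟩
      rcases satisfies_infiniteOrderCondition.1 h1 (fun i => (x i : G))
        (Subtype.val_injective.comp x.injective) with ⟨i, hi⟩ | ⟨i, j, hij⟩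
      · exact hi (htors _ (x i).2)
      · exact hij (htors _ (H.mul_mem (x i).2 (x j).2))
    have hfin : Finite H := by
      by_contra hinf
      have : Infinite H := not_finite_iff_infinite.1 hinf
      exact hno ⟨(Fin.valEmbedding).trans (Infinite.natEmbedding H)⟩
    have hcard : Nat.card H ≤ K₀ := by
      by_contra! hlt
      have := Fintype.ofFinite H
      rw [Nat.card_eq_fintype_card] at hlt
      exact hno (Function.Embedding.nonempty_of_card_le (by simpa using hlt))
    refine ⟨⊥, ?_, inferInstance, ?_⟩
    · simp
    · rw [Subgroup.index_bot]
      exact hcard.trans hK₀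
  · push Not at htors
    obtain ⟨g, hgH, hg⟩ := htors
    have hginf : ¬ IsOfFinOrder g := by rwa [hK.isOfFinOrder_iff]
    by_cases hall : ∀ x ∈ H, conjComm g x K.factorial = 1
    · right
      obtain ⟨M, ⟨hM, hgM⟩, -⟩ := hK.existsUnique_maximal g hginf
      exact (hK.isKVirtuallyAbelian g hginf M hM hgM).mono_subgroup fun x hx =>
        (hK.mem_iff hM hginf hgM).2 (hall x hx)
    · left
      push Not at hall
      obtain ⟨x, hxH, hx⟩ := hall
      have hmem : x * g ^ N * x⁻¹ ∈ H :=
        H.mul_mem (H.mul_mem hxH (H.pow_mem hgH N)) (H.inv_mem hxH)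
      refine ⟨FreeGroup.lift ![⟨g ^ N, H.pow_mem hgH N⟩, ⟨_, hmem⟩], ?_⟩
      rw [injective_iff_map_eq_one]
      intro w hw
      by_contra hw1
      refine satisfies_freeCondition.1 (h2 w hw1) g x hx ?_
      have : FreeGroup.lift ![g ^ N, x * g ^ N * x⁻¹] =
          H.subtype.comp (FreeGroup.lift ![⟨g ^ N, H.pow_mem hgH N⟩, ⟨_, hmem⟩]) := by
        ext i
        fin_cases i <;> simp
      rw [this, MonoidHom.comp_apply, hw, map_one]

theorem IsHyperbolicGroup.exists_isKCSA {Γ : Type v} [Group Γ] (hΓ : IsHyperbolicGroup Γ) :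
    ∃ K : ℕ, 0 < K ∧ ∀ (G : Type w) [Group G], IsLimitGroup Γ G →
      IsKCSA K G ∧ ∀ H : Subgroup G, ContainsFreeGroupTwo H ∨ IsKVirtuallyAbelian K H := by
  classical
  obtain ⟨ℓ, D, h⟩ := hΓ.exists_isHyperbolicLength
  obtain ⟨K₀, hK₀⟩ := h.exists_not_isOfFinOrder
  obtain ⟨N, hN⟩ := h.exists_injective_lift
  have hKCSA := h.isKCSA (card_le_of_forall_finset hK₀)
  have hle : K₀ ≤ K₀.factorial + K₀.factorial + K₀ := Nat.le_add_left _ _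
  have hpos : 0 < K₀.factorial + K₀.factorial + K₀ := by
    have := K₀.factorial_pos
    omega
  generalize K₀.factorial + K₀.factorial + K₀ = K at hKCSA hle hpos
  have h1 : Satisfies Γ (infiniteOrderCondition (K₀ + 1) K.factorial) := by
    refine satisfies_infiniteOrderCondition.2 fun x hx => ?_
    obtain ⟨u, hu, hinf⟩ := hK₀ (Finset.univ.image x) (by
      rw [Finset.card_image_of_injective _ hx]
      simp)
    rw [hKCSA.isOfFinOrder_iff] at hinf
    simp only [Finset.mem_image, Finset.mem_univ, true_and] at hu
    rcases hu with ⟨i, rfl⟩ | ⟨_, ⟨i, rfl⟩, _, ⟨j, rfl⟩, rfl⟩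
    · exact Or.inl ⟨i, hinf⟩
    · exact Or.inr ⟨i, j, hinf⟩
  have h2 : ∀ w, w ≠ 1 → Satisfies Γ (freeCondition K.factorial N w) := by
    intro w hw
    refine satisfies_freeCondition.2 fun g x hgx => ?_
    have hg : g ^ K.factorial ≠ 1 := by
      intro hg
      exact hgx (by simp [conjComm, hg])
    -- The maximality axioms, valid in `Γ`, reduce the non-commutation of all powers to the single
    -- exponent `K!`, which is what a quantifier-free condition can express.
    have hfree := hN g x (by rwa [hKCSA.isOfFinOrder_iff]) fun k hk hk' =>
      hgx (satisfies_maximalityAxiom.1 (hKCSA.satisfies (.maximality k hk)) g x hg hk')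
    exact fun hw' => hw (hfree (hw'.trans (map_one _).symm))
  refine ⟨K, hpos, fun G _ hG => ?_⟩
  have hGK := hKCSA.of_isLimitGroup hpos hG
  exact ⟨hGK, hGK.containsFreeGroupTwo_or hle
    ((isLocal_infiniteOrderCondition _ _).satisfies_of_isLimitGroup h1 hG)
    fun w hw => (isLocal_freeCondition _ _ _).satisfies_of_isLimitGroup (h2 w hw) hG⟩

end Limit

end KCSA

theorem mainTheorem12 :
    (∀ K : ℕ, 0 < K →
      (∃ T : KCSA.groupLanguage.Theory, (∀ φ ∈ T, φ.IsUniversal) ∧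
        ∀ (G : Type u) [Group G], KCSA.IsKCSA K G ↔ G ⊨ T) ∧
      (∀ (G : Type u) [Group G] (H : Subgroup G), KCSA.IsKCSA K G → KCSA.IsKCSA K H) ∧
      (∀ n : ℕ, IsClosed {N : KCSA.MarkedGroup n | KCSA.IsKCSA K N.group})) ∧
    (∀ (Γ : Type v) [Group Γ], KCSA.IsHyperbolicGroup Γ →
      ∃ K : ℕ, 0 < K ∧ ∀ (G : Type w) [Group G], KCSA.IsLimitGroup Γ G →
        KCSA.IsKCSA K G ∧
        ∀ H : Subgroup G, KCSA.ContainsFreeGroupTwo H ∨ KCSA.IsKVirtuallyAbelian K H) := by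
  refine ⟨fun K hK => ⟨KCSA.exists_universal_theory hK,
    fun G _ H hG => hG.of_injective hK H.subtype H.subtype_injective,
    fun n => KCSA.isClosed_isKCSA hK n⟩, fun Γ _ hΓ => hΓ.exists_isKCSA⟩
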